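/- Let $q\in\mathbb C^\times$ not be a root of unity, and write $[n]_q=(q^n-q^{-n})/(q-q^{-1})$. **Quantum group.** For $p\in\mathbb C^\times$, $p\neq\pm1$, let $\mathcal U_p=\mathcal U_p(\mathfrak{sl}_2)$ be the unital associative $\mathbb C$-algebra generated by $e,f,k^{\pm1}$ with relations $kk^{-1}=k^{-1}k=1$, $kek^{-1}=p^2e$, $kfk^{-1}=p^{-2}f$, $ef-fe=(k-k^{-1})/(p-p^{-1})$. For $\lambda\in\mathbb C^\times$ let $M_p(\lambda)$ be the quotient of $\mathcal U_p$ by the left ideal generated by $f$ and $k-\lambda$, and $L_p(\lambda)$ its unique irreducible quotient. For $m\in\frac12\mathbb Z$ write $L_{q^2}(m)$ for $L_{q^2}(q^{2m})$, so $L_{q^2}(\tfrac12-d)$ and $L_{q^2}(\tfrac32+d)$ have lowest weights $q^{1-2d}$ and $q^{3+2d}$. **Operators.** On $\mathcal P_2=\mathbb C[x_1,x_2]$ let $\gamma_j^{\pm1}$, $\mu_j$ and $\partial_{j,q^2}$ ($j=1,2$) be the linear operators $$\gamma_j^{\pm1}x^\alpha=q^{\pm\alpha_j}x^\alpha,\qquad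 \mu_jx^\alpha=x_jx^\alpha,\qquad \partial_{j,q^2}x^\alpha=[\alpha_j]_{q^2}x^{\alpha-\varepsilon_j},$$ where $\varepsilon_j$ is the $j$-th unit vector. On $\mathbb S=\mathbb C[y]$ let $\omega^{\pm1}y^c=q^{\pm c}y^c$, $\nu y^c=y^{c+1}$, $\nabla y^c=[c]_qy^{c-1}$. Put $\mathbb S_+=\mathbb C[y^2]$, $\mathbb S_-=y\,\mathbb C[y^2]$, $\mathcal P(\mathbb S)=\mathcal P_2\otimes\mathbb S$, $\mathcal P(\mathbb S)^d=\mathcal P_2^d\otimes\mathbb S$ and $\mathcal P(\mathbb S)^d_\pm=\mathcal P_2^d\otimes\mathbb S_\pm$, where $\mathcal P_2^d$ is the space of homogeneous polynomials of degree $d$. The algebra $\mathcal U_{q^2}$ acts on $\mathcal P(\mathbb S)$ by $$k\mapsto q\gamma_1^2\gamma_2^{-2}\omega^2,\qquad e\mapsto q\,\omega^2\mu_1\partial_{2,q^2}+\frac{\nu^2}{[2]_q},\qquad f\mapsto \mu_2\partial_{1,q^2}-\frac{\gamma_1^{-2}\gamma_2^2}{[2]_q}\nabla^2 .$$ Define the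 operators on $\mathcal P(\mathbb S)$ $$E=[2]_q\left(q^2\gamma_2^2\,\omega\,\mu_1\nabla+\mu_2\nu\right),\qquad F=\partial_{1,q^2}\,\nu-\gamma_1^{-2}\,\omega\,\partial_{2,q^2}\nabla ,$$ and the spaces $\mathcal M^d=\ker F\cap\mathcal P(\mathbb S)^d$ (symplectic monogenics of degree $d$) and $\mathcal M^d_\pm=\ker F\cap\mathcal P(\mathbb S)^d_\pm$. **Theorem.** For every integer $d\ge0$: 1. $\mathcal M^d=\mathcal M^d_+\oplus\mathcal M^d_-$, and $\mathcal M^d_+$, $\mathcal M^d_-$ are irreducible $\mathcal U_{q^2}$-submodules of $\mathcal P(\mathbb S)$ with $\mathcal M^d_+\cong L_{q^2}(\tfrac12-d)$ and $\mathcal M^d_-\cong L_{q^2}(\tfrac32+d)$. 2. ($q$-Fischer decomposition) $\mathcal P(\mathbb S)^d=\bigoplus_{k=0}^dE^k(\mathcal M^{d-k})$, an internal direct sum of $\mathcal U_{q^2}$-submodules. -/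

import Mathlib

open scoped TensorProduct

noncomputable section

namespace QMeta

/-! ### The quantized enveloping algebra of `sl₂` and its lowest weight modules -/

/-- The generators `e, f, k, k⁻¹`. -/
inductive Gen
  | e | f | k | kinv

/-- The defining relations of `U_q(sl₂)`, imposed on the free algebra on `e, f, k, k⁻¹`. -/
inductive Rel (q : ℂˣ) : FreeAlgebra ℂ Gen → FreeAlgebra ℂ Gen → Prop
  | k_kinv : Rel q (FreeAlgebra.ι ℂ Gen.k * FreeAlgebra.ι ℂ Gen.kinv) 1
  | kinv_k : Rel q (FreeAlgebra.ι ℂ Gen.kinv * FreeAlgebra.ι ℂ Gen.k) 1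
  | k_e : Rel q
      (FreeAlgebra.ι ℂ Gen.k * FreeAlgebra.ι ℂ Gen.e * FreeAlgebra.ι ℂ Gen.kinv)
      ((q : ℂ) ^ 2 • FreeAlgebra.ι ℂ Gen.e)
  | k_f : Rel q
      (FreeAlgebra.ι ℂ Gen.k * FreeAlgebra.ι ℂ Gen.f * FreeAlgebra.ι ℂ Gen.kinv)
      (((q : ℂ) ^ 2)⁻¹ • FreeAlgebra.ι ℂ Gen.f)
  | e_f : Rel q
      (FreeAlgebra.ι ℂ Gen.e * FreeAlgebra.ι ℂ Gen.f
        - FreeAlgebra.ι ℂ Gen.f * FreeAlgebra.ι ℂ Gen.e)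
      (((q : ℂ) - (q : ℂ)⁻¹)⁻¹ • (FreeAlgebra.ι ℂ Gen.k - FreeAlgebra.ι ℂ Gen.kinv))

/-- The quantized enveloping algebra `U_q(sl₂)` (used below with parameter `q²`). -/
def Uq (q : ℂˣ) : Type := RingQuot (Rel q)

instance (q : ℂˣ) : Ring (Uq q) := inferInstanceAs (Ring (RingQuot (Rel q)))

instance (q : ℂˣ) : Algebra ℂ (Uq q) := inferInstanceAs (Algebra ℂ (RingQuot (Rel q)))

/-- The quotient map from the free algebra. -/
def Uq.mk (q : ℂˣ) : FreeAlgebra ℂ Gen →ₐ[ℂ] Uq q := RingQuot.mkAlgHom ℂ (Rel q)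

/-- The image in `U_q(sl₂)` of a generator. -/
def Uq.gen (q : ℂˣ) (g : Gen) : Uq q := Uq.mk q (FreeAlgebra.ι ℂ g)

/-- A homomorphism on the free algebra that respects the relations descends to `U_q(sl₂)`. -/
def Uq.lift {q : ℂˣ} {A : Type} [Ring A] [Algebra ℂ A] (φ : FreeAlgebra ℂ Gen →ₐ[ℂ] A)
    (h : ∀ ⦃x y⦄, Rel q x y → φ x = φ y) : Uq q →ₐ[ℂ] A :=
  RingQuot.liftAlgHom ℂ ⟨φ, h⟩

theorem Uq.lift_mk {q : ℂˣ} {A : Type} [Ring A] [Algebra ℂ A] (φ : FreeAlgebra ℂ Gen →ₐ[ℂ] A)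
    (h : ∀ ⦃x y⦄, Rel q x y → φ x = φ y) (x : FreeAlgebra ℂ Gen) :
    Uq.lift φ h (Uq.mk q x) = φ x :=
  RingQuot.liftAlgHom_mkAlgHom_apply ℂ φ h x

/-- The left ideal of `U_q(sl₂)` generated by `f` and `k - l`. -/
def vermaIdeal (q l : ℂˣ) : Submodule (Uq q) (Uq q) :=
  Submodule.span (Uq q) {Uq.gen q Gen.f, Uq.gen q Gen.k - algebraMap ℂ (Uq q) (l : ℂ)}

/-- The lowest weight Verma module `M_q(l)`, on which `f` kills the cyclic vector and `k` acts
on it by `l`. -/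
abbrev Verma (q l : ℂˣ) : Type := Uq q ⧸ vermaIdeal q l

/-- The sum of all proper submodules of `M_q(l)`; this is its unique maximal submodule. -/
def vermaRad (q l : ℂˣ) : Submodule (Uq q) (Verma q l) :=
  sSup {N : Submodule (Uq q) (Verma q l) | N ≠ ⊤}

/-- The irreducible lowest weight module `L_q(l)`: the irreducible quotient of `M_q(l)`. -/
abbrev LMod (q l : ℂˣ) : Type := Verma q l ⧸ vermaRad q l

/-! ### `q`-differential operators on polynomials -/

/-- The polynomial space `P_N = ℂ[x_1, …, x_N]`. -/
abbrev Poly (N : ℕ) : Type := MvPolynomial (Fin N) ℂ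

/-- The quantum integer `[n]_q = (q^n - q^{-n}) / (q - q^{-1})`. -/
def qInt (q : ℂˣ) (n : ℕ) : ℂ :=
  ((q : ℂ) ^ n - ((q : ℂ) ^ n)⁻¹) / ((q : ℂ) - (q : ℂ)⁻¹)

/-- The linear map on `P_N` with prescribed values on the monomials `x^α`. -/
def onMonomials {N : ℕ} (g : (Fin N →₀ ℕ) → Poly N) : Module.End ℂ (Poly N) :=
  (MvPolynomial.basisMonomials (Fin N) ℂ).constr ℂ g

/-- The degree operator `γ_j : x^α ↦ q^{α_j} x^α`. Its inverse is `gam q⁻¹ j`. -/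
def gam (q : ℂˣ) {N : ℕ} (j : Fin N) : Module.End ℂ (Poly N) :=
  onMonomials fun α => MvPolynomial.monomial α ((q : ℂ) ^ α j)

/-- The multiplication operator `μ_j : x^α ↦ x_j x^α`. -/
def mu {N : ℕ} (j : Fin N) : Module.End ℂ (Poly N) :=
  LinearMap.mulLeft ℂ (MvPolynomial.X j)

/-- The `q`-derivative `∂_{j,q} : x^α ↦ [α_j]_q x^{α - ε_j}`. -/
def qDer (q : ℂˣ) {N : ℕ} (j : Fin N) : Module.End ℂ (Poly N) :=
  onMonomials fun α => MvPolynomial.monomial (α - Finsupp.single j 1) (qInt q (α j))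

/-! ### The two `U_{q²}(sl₂)`-actions, on `P_2` and on the symplectic spinors `S = P_1 = ℂ[y]` -/

/-- `K_w = γ_1² γ_2⁻²`. -/
def Kw (q : ℂˣ) : Module.End ℂ (Poly 2) := gam q 0 ^ 2 * gam q⁻¹ 1 ^ 2
/-- `K_w⁻¹ = γ_1⁻² γ_2²`. -/
def KwInv (q : ℂˣ) : Module.End ℂ (Poly 2) := gam q⁻¹ 0 ^ 2 * gam q 1 ^ 2
/-- `E_w = μ_1 ∂_{2,q²}`. -/
def Ew (q : ℂˣ) : Module.End ℂ (Poly 2) := mu 0 * qDer (q ^ 2) 1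
/-- `F_w = μ_2 ∂_{1,q²}`. -/
def Fw (q : ℂˣ) : Module.End ℂ (Poly 2) := mu 1 * qDer (q ^ 2) 0

/-- `K_s = q ω²`, where `ω` is the degree operator in `y`. -/
def Ks (q : ℂˣ) : Module.End ℂ (Poly 1) := (q : ℂ) • gam q 0 ^ 2
/-- `K_s⁻¹ = q⁻¹ ω⁻²`. -/
def KsInv (q : ℂˣ) : Module.End ℂ (Poly 1) := (q : ℂ)⁻¹ • gam q⁻¹ 0 ^ 2
/-- `E_s = ν² / [2]_q`, where `ν` is multiplication by `y`. -/
def Es (q : ℂˣ) : Module.End ℂ (Poly 1) := (qInt q 2)⁻¹ • mu 0 ^ 2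
/-- `F_s = - ∇² / [2]_q`, where `∇` is the `q`-derivative in `y`. -/
def Fs (q : ℂˣ) : Module.End ℂ (Poly 1) := -((qInt q 2)⁻¹ • qDer q 0 ^ 2)

/-! ### Polynomial symplectic spinors and the diagonal action -/

/-- The space `P(S) = P_2 ⊗ S` of polynomial symplectic spinors. -/
def PolySpinor : Type := Poly 2 ⊗[ℂ] Poly 1

instance : AddCommGroup PolySpinor := inferInstanceAs (AddCommGroup (Poly 2 ⊗[ℂ] Poly 1))

instance : Module ℂ PolySpinor := inferInstanceAs (Module ℂ (Poly 2 ⊗[ℂ] Poly 1))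

/-- The canonical bilinear map `(p, s) ↦ p ⊗ s` from `P_2 × S` to `P(S)`. -/
def tmk : Poly 2 →ₗ[ℂ] Poly 1 →ₗ[ℂ] PolySpinor := TensorProduct.mk ℂ (Poly 2) (Poly 1)

/-- The operator `A ⊗ B` on `P(S)`. -/
def tens (A : Module.End ℂ (Poly 2)) (B : Module.End ℂ (Poly 1)) : Module.End ℂ PolySpinor :=
  TensorProduct.map (R := ℂ) A B

/-- The diagonal action on generators, obtained from the comultiplication
`Δ e = e ⊗ k + 1 ⊗ e`, `Δ f = f ⊗ 1 + k⁻¹ ⊗ f`, `Δ k^{±1} = k^{±1} ⊗ k^{±1}`. -/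
def sigmaGen (q : ℂˣ) : Gen → Module.End ℂ PolySpinor
  | Gen.e => tens (Ew q) (Ks q) + tens 1 (Es q)
  | Gen.f => tens (Fw q) 1 + tens (KwInv q) (Fs q)
  | Gen.k => tens (Kw q) (Ks q)
  | Gen.kinv => tens (KwInv q) (KsInv q)


/-! ### Verification of the relations -/

theorem onMonomials_monomial {N : ℕ} (g : (Fin N →₀ ℕ) → Poly N) (α : Fin N →₀ ℕ) (c : ℂ) :
    onMonomials g (MvPolynomial.monomial α c) = c • g α := by
  have h := (MvPolynomial.basisMonomials (Fin N) ℂ).constr_basis ℂ g α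
  rw [MvPolynomial.coe_basisMonomials] at h
  have h2 : MvPolynomial.monomial α c = c • (MvPolynomial.monomial α (1 : ℂ)) := by
    rw [MvPolynomial.smul_monomial, smul_eq_mul, mul_one]
  rw [h2, map_smul]
  exact congrArg _ h

theorem gam_monomial (q : ℂˣ) {N : ℕ} (j : Fin N) (α : Fin N →₀ ℕ) (c : ℂ) :
    gam q j (MvPolynomial.monomial α c) = MvPolynomial.monomial α ((q : ℂ) ^ α j * c) := by
  rw [gam, onMonomials_monomial, MvPolynomial.smul_monomial, smul_eq_mul, mul_comm]

theorem mu_monomial {N : ℕ} (j : Fin N) (α : Fin N →₀ ℕ) (c : ℂ) :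
    mu j (MvPolynomial.monomial α c) = MvPolynomial.monomial (α + Finsupp.single j 1) c := by
  rw [mu, LinearMap.mulLeft_apply, MvPolynomial.X, MvPolynomial.monomial_mul, one_mul, add_comm]

theorem qDer_monomial (q : ℂˣ) {N : ℕ} (j : Fin N) (α : Fin N →₀ ℕ) (c : ℂ) :
    qDer q j (MvPolynomial.monomial α c)
      = MvPolynomial.monomial (α - Finsupp.single j 1) (qInt q (α j) * c) := by
  rw [qDer, onMonomials_monomial, MvPolynomial.smul_monomial, smul_eq_mul, mul_comm]

theorem end_ext {N : ℕ} {A B : Module.End ℂ (Poly N)}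
    (h : ∀ α, A (MvPolynomial.monomial α 1) = B (MvPolynomial.monomial α 1)) : A = B := by
  refine (MvPolynomial.basisMonomials (Fin N) ℂ).ext fun α => ?_
  rw [MvPolynomial.coe_basisMonomials]
  exact h α

theorem qInt_zero (q : ℂˣ) : qInt q 0 = 0 := by simp [qInt]

theorem Kw_mul_KwInv (q : ℂˣ) : Kw q * KwInv q = 1 := by
  refine end_ext fun α => ?_
  simp only [Kw, KwInv, pow_two, Module.End.mul_apply, gam_monomial, Module.End.one_apply]
  congr 1
  simp only [Units.val_inv_eq_inv_val, inv_pow]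
  have hq : (q : ℂ) ≠ 0 := q.ne_zero
  field_simp

theorem KwInv_mul_Kw (q : ℂˣ) : KwInv q * Kw q = 1 := by
  refine end_ext fun α => ?_
  simp only [Kw, KwInv, pow_two, Module.End.mul_apply, gam_monomial, Module.End.one_apply]
  congr 1
  simp only [Units.val_inv_eq_inv_val, inv_pow]
  have hq : (q : ℂ) ≠ 0 := q.ne_zero
  field_simp

theorem Ks_mul_KsInv (q : ℂˣ) : Ks q * KsInv q = 1 := by
  refine end_ext fun α => ?_
  simp only [Ks, KsInv, pow_two, Module.End.mul_apply, LinearMap.smul_apply,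
    gam_monomial, Module.End.one_apply, MvPolynomial.smul_monomial, smul_eq_mul]
  congr 1
  simp only [Units.val_inv_eq_inv_val, inv_pow]
  have hq : (q : ℂ) ≠ 0 := q.ne_zero
  field_simp

theorem KsInv_mul_Ks (q : ℂˣ) : KsInv q * Ks q = 1 := by
  refine end_ext fun α => ?_
  simp only [Ks, KsInv, pow_two, Module.End.mul_apply, LinearMap.smul_apply,
    gam_monomial, Module.End.one_apply, MvPolynomial.smul_monomial, smul_eq_mul]
  congr 1
  simp only [Units.val_inv_eq_inv_val, inv_pow]
  have hq : (q : ℂ) ≠ 0 := q.ne_zero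
  field_simp

theorem Kw_mul_Ew (q : ℂˣ) : Kw q * Ew q = (q : ℂ) ^ 4 • (Ew q * Kw q) := by
  refine end_ext fun α => ?_
  simp only [Kw, Ew, pow_two, Module.End.mul_apply, LinearMap.smul_apply,
    gam_monomial, mu_monomial, qDer_monomial, MvPolynomial.smul_monomial, smul_eq_mul]
  congr 1
  rcases h : α 1 with _ | n
  · simp [qInt_zero]
  · simp only [Units.val_inv_eq_inv_val, Finsupp.add_apply, Finsupp.tsub_apply,
      Finsupp.single_apply, h]
    have hq : (q : ℂ) ≠ 0 := q.ne_zero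
    simp
    field_simp
    ring

theorem Kw_mul_Fw (q : ℂˣ) : Kw q * Fw q = ((q : ℂ) ^ 4)⁻¹ • (Fw q * Kw q) := by
  refine end_ext fun α => ?_
  simp only [Kw, Fw, pow_two, Module.End.mul_apply, LinearMap.smul_apply,
    gam_monomial, mu_monomial, qDer_monomial, MvPolynomial.smul_monomial, smul_eq_mul]
  congr 1
  rcases h : α 0 with _ | n
  · simp [qInt_zero]
  · simp only [Units.val_inv_eq_inv_val, Finsupp.add_apply, Finsupp.tsub_apply,
      Finsupp.single_apply, h]
    have hq : (q : ℂ) ≠ 0 := q.ne_zero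
    simp
    field_simp
    ring

theorem Ks_mul_Es (q : ℂˣ) : Ks q * Es q = (q : ℂ) ^ 4 • (Es q * Ks q) := by
  refine end_ext fun α => ?_
  simp only [Ks, Es, pow_two, Module.End.mul_apply, LinearMap.smul_apply,
    gam_monomial, mu_monomial, MvPolynomial.smul_monomial, smul_eq_mul]
  congr 1
  simp
  ring

theorem Ks_mul_Fs (q : ℂˣ) : Ks q * Fs q = ((q : ℂ) ^ 4)⁻¹ • (Fs q * Ks q) := by
  refine end_ext fun α => ?_
  simp only [Ks, Fs, pow_two, Module.End.mul_apply, LinearMap.smul_apply,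
    LinearMap.neg_apply, map_neg, smul_neg,
    gam_monomial, qDer_monomial, MvPolynomial.smul_monomial, smul_eq_mul]
  congr 2
  have hq : (q : ℂ) ≠ 0 := q.ne_zero
  rcases h : α 0 with _ | _ | n
  · simp [qInt_zero]
  · simp [qInt_zero, h]
  · simp [h]
    field_simp
    ring

theorem Ew_Fw (q : ℂˣ) : Ew q * Fw q - Fw q * Ew q
    = (((q ^ 2 : ℂˣ) : ℂ) - ((q ^ 2 : ℂˣ) : ℂ)⁻¹)⁻¹ • (Kw q - KwInv q) := by
  refine end_ext fun α => ?_
  obtain ⟨a, ha⟩ : ∃ a, α 0 = a := ⟨_, rfl⟩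
  obtain ⟨b, hb⟩ : ∃ b, α 1 = b := ⟨_, rfl⟩
  have hq : (q : ℂ) ≠ 0 := q.ne_zero
  have e1 : Ew q (Fw q (MvPolynomial.monomial α 1))
      = MvPolynomial.monomial α (qInt (q ^ 2) (b + 1) * qInt (q ^ 2) a) := by
    simp only [Ew, Fw, Module.End.mul_apply, mu_monomial, qDer_monomial]
    rcases a with _ | a
    · simp [qInt_zero, ha]
    · congr 1
      · congr 1
        refine Finsupp.ext fun i => ?_
        fin_cases i <;> simp [ha]
      · simp [ha, hb]
  have e2 : Fw q (Ew q (MvPolynomial.monomial α 1))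
      = MvPolynomial.monomial α (qInt (q ^ 2) (a + 1) * qInt (q ^ 2) b) := by
    simp only [Ew, Fw, Module.End.mul_apply, mu_monomial, qDer_monomial]
    rcases b with _ | b
    · simp [qInt_zero, hb]
    · congr 1
      · congr 1
        refine Finsupp.ext fun i => ?_
        fin_cases i <;> simp [hb]
      · simp [ha, hb]
  rw [LinearMap.sub_apply, Module.End.mul_apply, Module.End.mul_apply, e1, e2]
  simp only [Kw, KwInv, pow_two (gam _ _), Module.End.mul_apply, LinearMap.smul_apply,
    LinearMap.sub_apply, gam_monomial, ← map_sub, MvPolynomial.smul_monomial, smul_eq_mul, ha, hb]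
  congr 1
  simp only [qInt, Units.val_inv_eq_inv_val, Units.val_pow_eq_pow_val, ← pow_mul]
  by_cases hd : (q : ℂ) ^ 2 - ((q : ℂ) ^ 2)⁻¹ = 0
  · simp [hd]
  · have hx : (q : ℂ) ^ a ≠ 0 := pow_ne_zero _ hq
    have hy : (q : ℂ) ^ b ≠ 0 := pow_ne_zero _ hq
    have hd' : (q : ℂ) ^ 4 - 1 ≠ 0 := fun h => hd <| by
      field_simp
      linear_combination h
    have p1 : (q : ℂ) ^ (2 * (b + 1)) = (q : ℂ) ^ 2 * ((q : ℂ) ^ b) ^ 2 := by ring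
    have p2 : (q : ℂ) ^ (2 * (a + 1)) = (q : ℂ) ^ 2 * ((q : ℂ) ^ a) ^ 2 := by ring
    have p3 : (q : ℂ) ^ (2 * a) = ((q : ℂ) ^ a) ^ 2 := by ring
    have p4 : (q : ℂ) ^ (2 * b) = ((q : ℂ) ^ b) ^ 2 := by ring
    simp only [p1, p2, p3, p4, inv_pow]
    generalize (q : ℂ) ^ a = x at *
    generalize (q : ℂ) ^ b = y at *
    generalize (q : ℂ) = t at *
    field_simp
    ring

theorem Es_Fs (q : ℂˣ) : Es q * Fs q - Fs q * Es q
    = (((q ^ 2 : ℂˣ) : ℂ) - ((q ^ 2 : ℂˣ) : ℂ)⁻¹)⁻¹ • (Ks q - KsInv q) := by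
  refine end_ext fun α => ?_
  obtain ⟨c, hc⟩ : ∃ c, α 0 = c := ⟨_, rfl⟩
  have hq : (q : ℂ) ≠ 0 := q.ne_zero
  have e1 : Es q (Fs q (MvPolynomial.monomial α 1)) = MvPolynomial.monomial α
      (-((qInt q 2)⁻¹ * ((qInt q 2)⁻¹ * (qInt q (c - 1) * qInt q c)))) := by
    simp only [Es, Fs, pow_two, Module.End.mul_apply, LinearMap.smul_apply, LinearMap.neg_apply,
      map_neg, mu_monomial, qDer_monomial, MvPolynomial.smul_monomial, smul_eq_mul]
    rcases c with _ | _ | c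
    · simp [qInt_zero, hc]
    · simp [qInt_zero, hc]
    · congr 2
      · congr 1
        refine Finsupp.ext fun i => ?_
        fin_cases i
        simp [hc]
      · simp [hc]
  have e2 : Fs q (Es q (MvPolynomial.monomial α 1)) = MvPolynomial.monomial α
      (-((qInt q 2)⁻¹ * ((qInt q 2)⁻¹ * (qInt q (c + 1) * qInt q (c + 2))))) := by
    simp only [Es, Fs, pow_two, Module.End.mul_apply, LinearMap.smul_apply, LinearMap.neg_apply,
      map_neg, mu_monomial, qDer_monomial, MvPolynomial.smul_monomial, smul_eq_mul]
    congr 2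
    · congr 1
      refine Finsupp.ext fun i => ?_
      fin_cases i
      simp [hc]
    · simp [hc, add_assoc]
      left
      ring
  rw [LinearMap.sub_apply, Module.End.mul_apply, Module.End.mul_apply, e1, e2]
  simp only [Ks, KsInv, pow_two (gam _ _), Module.End.mul_apply, LinearMap.smul_apply,
    LinearMap.sub_apply, gam_monomial, ← map_sub, MvPolynomial.smul_monomial, smul_eq_mul, hc]
  congr 1
  by_cases hd : (q : ℂ) ^ 2 - ((q : ℂ) ^ 2)⁻¹ = 0
  · simp [qInt, hd]
  · have h1 : (q : ℂ) ^ 4 - 1 ≠ 0 := fun h => hd <| by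
      field_simp
      linear_combination h
    have h2 : (q : ℂ) ^ 2 - 1 ≠ 0 := fun h => h1 <| by
      linear_combination ((q : ℂ) ^ 2 + 1) * h
    have h3 : (q : ℂ) ^ 2 + 1 ≠ 0 := fun h => h1 <| by
      linear_combination ((q : ℂ) ^ 2 - 1) * h
    have hx : (q : ℂ) ^ c ≠ 0 := pow_ne_zero _ hq
    have i2 : qInt q 2 = ((q : ℂ) ^ 2 + 1) / (q : ℂ) := by
      rw [qInt]
      field_simp
      ring
    have j0 : qInt q c = (((q : ℂ) ^ c) ^ 2 - 1) * q / ((q : ℂ) ^ c * ((q : ℂ) ^ 2 - 1)) := by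
      rw [qInt]
      field_simp
    have jm : qInt q (c - 1) * qInt q c = (((q : ℂ) ^ c) ^ 2 - q ^ 2) / ((q : ℂ) ^ c * ((q : ℂ) ^ 2 - 1))
        * qInt q c := by
      rcases c with _ | c
      · simp [qInt_zero]
      · congr 1
        have hx' : (q : ℂ) ^ c ≠ 0 := pow_ne_zero _ hq
        rw [qInt, Nat.add_sub_cancel]
        field_simp
        ring
    have j1 : qInt q (c + 1) = (((q : ℂ) ^ c) ^ 2 * q ^ 2 - 1) / ((q : ℂ) ^ c * ((q : ℂ) ^ 2 - 1)) := by
      rw [qInt]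
      field_simp
      ring
    have j2 : qInt q (c + 2)
        = (((q : ℂ) ^ c) ^ 2 * q ^ 4 - 1) / (q * (q : ℂ) ^ c * ((q : ℂ) ^ 2 - 1)) := by
      rw [qInt]
      field_simp
      ring
    rw [jm, j0, j1, j2, i2]
    simp only [Units.val_inv_eq_inv_val, Units.val_pow_eq_pow_val, inv_pow]
    generalize (q : ℂ) ^ c = x at *
    generalize (q : ℂ) = t at *
    field_simp
    ring

theorem tens_tmk (A : Module.End ℂ (Poly 2)) (B : Module.End ℂ (Poly 1)) (p : Poly 2)
    (s : Poly 1) : tens A B (tmk p s) = tmk (A p) (B s) := rfl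

theorem spinor_ext {A B : Module.End ℂ PolySpinor}
    (h : ∀ p s, A (tmk p s) = B (tmk p s)) : A = B :=
  TensorProduct.ext' (R := ℂ) (M := Poly 2) (N := Poly 1) h

theorem tens_mul (A A' : Module.End ℂ (Poly 2)) (B B' : Module.End ℂ (Poly 1)) :
    tens A B * tens A' B' = tens (A * A') (B * B') :=
  spinor_ext fun _ _ => rfl

theorem tens_one : tens 1 1 = 1 := spinor_ext fun _ _ => rfl

theorem tens_smul (c : ℂ) (A : Module.End ℂ (Poly 2)) (B : Module.End ℂ (Poly 1)) :
    tens (c • A) B = c • tens A B :=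
  spinor_ext fun p s => by
    rw [LinearMap.smul_apply, tens_tmk, tens_tmk, LinearMap.smul_apply, map_smul,
      LinearMap.smul_apply]

theorem tens_smul' (c : ℂ) (A : Module.End ℂ (Poly 2)) (B : Module.End ℂ (Poly 1)) :
    tens A (c • B) = c • tens A B :=
  spinor_ext fun p s => by
    rw [LinearMap.smul_apply, tens_tmk, tens_tmk, LinearMap.smul_apply, map_smul]

theorem tens_sub (A A' : Module.End ℂ (Poly 2)) (B : Module.End ℂ (Poly 1)) :
    tens (A - A') B = tens A B - tens A' B :=
  spinor_ext fun p s => by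
    rw [LinearMap.sub_apply, tens_tmk, tens_tmk, tens_tmk, LinearMap.sub_apply, map_sub,
      LinearMap.sub_apply]

theorem tens_sub' (A : Module.End ℂ (Poly 2)) (B B' : Module.End ℂ (Poly 1)) :
    tens A (B - B') = tens A B - tens A B' :=
  spinor_ext fun p s => by
    rw [LinearMap.sub_apply, tens_tmk, tens_tmk, tens_tmk, LinearMap.sub_apply, map_sub]

theorem KwInv_mul_Ew (q : ℂˣ) : KwInv q * Ew q = ((q : ℂ) ^ 4)⁻¹ • (Ew q * KwInv q) := by
  have hq : (q : ℂ) ^ 4 ≠ 0 := pow_ne_zero _ q.ne_zero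
  have h := congrArg (fun A => KwInv q * A * KwInv q) (Kw_mul_Ew q)
  simp only [mul_smul_comm, smul_mul_assoc] at h
  rw [← mul_assoc, KwInv_mul_Kw, one_mul, mul_assoc, mul_assoc, Kw_mul_KwInv, mul_one] at h
  rw [h, smul_smul, inv_mul_cancel₀ hq, one_smul]

/-- The diagonal action satisfies the defining relations of `U_{q²}(sl₂)`. -/
theorem sigmaGen_rel (q : ℂˣ) {x y : FreeAlgebra ℂ Gen} (h : Rel (q ^ 2) x y) :
    FreeAlgebra.lift ℂ (sigmaGen q) x = FreeAlgebra.lift ℂ (sigmaGen q) y := by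
  have hq4 : ((q : ℂ) ^ 2) ^ 2 = (q : ℂ) ^ 4 := by ring
  have hk : tens (Kw q) (Ks q) * tens (KwInv q) (KsInv q) = 1 := by
    rw [tens_mul, Kw_mul_KwInv, Ks_mul_KsInv, tens_one]
  have hk' : tens (KwInv q) (KsInv q) * tens (Kw q) (Ks q) = 1 := by
    rw [tens_mul, KwInv_mul_Kw, KsInv_mul_Ks, tens_one]
  have hKF : Kw q * KwInv q = KwInv q * Kw q := by rw [Kw_mul_KwInv, KwInv_mul_Kw]
  cases h with
  | k_kinv =>
    simp only [map_mul, FreeAlgebra.lift_ι_apply, map_one, sigmaGen]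
    exact hk
  | kinv_k =>
    simp only [map_mul, FreeAlgebra.lift_ι_apply, map_one, sigmaGen]
    exact hk'
  | k_e =>
    simp only [map_mul, map_smul, FreeAlgebra.lift_ι_apply, sigmaGen,
      Units.val_pow_eq_pow_val, hq4]
    have h1 : tens (Kw q) (Ks q) * (tens (Ew q) (Ks q) + tens 1 (Es q))
        = (q : ℂ) ^ 4 • ((tens (Ew q) (Ks q) + tens 1 (Es q)) * tens (Kw q) (Ks q)) := by
      rw [mul_add, add_mul, tens_mul, tens_mul, tens_mul, tens_mul, Kw_mul_Ew, Ks_mul_Es,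
        tens_smul, tens_smul', smul_add, one_mul, mul_one]
    rw [h1, smul_mul_assoc, mul_assoc, hk, mul_one]
  | k_f =>
    simp only [map_mul, map_smul, FreeAlgebra.lift_ι_apply, sigmaGen,
      Units.val_pow_eq_pow_val, hq4]
    have h1 : tens (Kw q) (Ks q) * (tens (Fw q) 1 + tens (KwInv q) (Fs q))
        = ((q : ℂ) ^ 4)⁻¹ • ((tens (Fw q) 1 + tens (KwInv q) (Fs q)) * tens (Kw q) (Ks q)) := by
      rw [mul_add, add_mul, tens_mul, tens_mul, tens_mul, tens_mul, Kw_mul_Fw, Ks_mul_Fs,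
        tens_smul, tens_smul', smul_add, one_mul, mul_one, hKF]
    rw [h1, smul_mul_assoc, mul_assoc, hk, mul_one]
  | e_f =>
    simp only [map_mul, map_sub, map_smul, FreeAlgebra.lift_ι_apply, sigmaGen]
    have h1 : tens (Ew q * KwInv q) (Ks q * Fs q) = tens (KwInv q * Ew q) (Fs q * Ks q) := by
      rw [Ks_mul_Fs, KwInv_mul_Ew, tens_smul, tens_smul']
    have h2 : tens (Ew q * Fw q) (Ks q) - tens (Fw q * Ew q) (Ks q)
        = (((q ^ 2 : ℂˣ) : ℂ) - ((q ^ 2 : ℂˣ) : ℂ)⁻¹)⁻¹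
          • (tens (Kw q) (Ks q) - tens (KwInv q) (Ks q)) := by
      rw [← tens_sub, Ew_Fw, tens_smul, tens_sub]
    have h3 : tens (KwInv q) (Es q * Fs q) - tens (KwInv q) (Fs q * Es q)
        = (((q ^ 2 : ℂˣ) : ℂ) - ((q ^ 2 : ℂˣ) : ℂ)⁻¹)⁻¹
          • (tens (KwInv q) (Ks q) - tens (KwInv q) (KsInv q)) := by
      rw [← tens_sub', Es_Fs, tens_smul', tens_sub']
    have h4 := congrArg₂ (· + ·) h2 h3
    simp only [← smul_add] at h4
    rw [sub_add_sub_cancel] at h4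
    rw [← h4]
    simp only [mul_add, add_mul, tens_mul, one_mul, mul_one, h1]
    abel

/-- The diagonal representation `σ_Δ : U_{q²}(sl₂) → End(P(S))`. -/
def sigmaDelta (q : ℂˣ) : Uq (q ^ 2) →ₐ[ℂ] Module.End ℂ PolySpinor :=
  Uq.lift (FreeAlgebra.lift ℂ (sigmaGen q)) fun _ _ h => sigmaGen_rel q h

/-- `P(S)` as a `U_{q²}(sl₂)`-module through the diagonal representation. -/
instance polySpinorModule (q : ℂˣ) : Module (Uq (q ^ 2)) PolySpinor :=
  Module.compHom PolySpinor (sigmaDelta q).toRingHom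

theorem smul_def (q : ℂˣ) (u : Uq (q ^ 2)) (p : PolySpinor) : u • p = sigmaDelta q u p := rfl

theorem gen_smul (q : ℂˣ) (g : Gen) (p : PolySpinor) :
    Uq.gen (q ^ 2) g • p = sigmaGen q g p := by
  rw [smul_def, sigmaDelta, Uq.gen, Uq.lift_mk,
    FreeAlgebra.lift_ι_apply]

instance polySpinorTower (q : ℂˣ) : IsScalarTower ℂ (Uq (q ^ 2)) PolySpinor where
  smul_assoc c u p := by
    rw [smul_def, smul_def, map_smul, LinearMap.smul_apply]

/-! ### The dual pair operators and the monogenics -/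

/-- The raising operator `E = [2]_q (q² γ_2² ω μ_1 ∇ + μ_2 ν)` on `P(S)`. -/
def opE (q : ℂˣ) : Module.End ℂ PolySpinor :=
  qInt q 2 • ((q : ℂ) ^ 2 • tens (gam q 1 ^ 2 * mu 0) (gam q 0 * qDer q 0) + tens (mu 1) (mu 0))

/-- The `q`-symplectic Dirac operator `F = ∂_{1,q²} ν - γ_1⁻² ω ∂_{2,q²} ∇` on `P(S)`. -/
def opF (q : ℂˣ) : Module.End ℂ PolySpinor :=
  tens (qDer (q ^ 2) 0) (mu 0)
    - tens (gam q⁻¹ 0 ^ 2 * qDer (q ^ 2) 1) (gam q 0 * qDer q 0)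

/-- The even spinors `S_+ = ℂ[y²]`. -/
def spinorPlus : Submodule ℂ (Poly 1) :=
  Submodule.span ℂ (Set.range fun n : ℕ => (MvPolynomial.X 0 : Poly 1) ^ (2 * n))

/-- The odd spinors `S_- = y ℂ[y²]`. -/
def spinorMinus : Submodule ℂ (Poly 1) :=
  Submodule.span ℂ (Set.range fun n : ℕ => (MvPolynomial.X 0 : Poly 1) ^ (2 * n + 1))

/-- The subspace `P_2^d ⊗ W` of `P(S)`, for a subspace `W` of `S`, where `P_2^d` consists of the
homogeneous polynomials of degree `d` in `x_1, x_2`. -/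
def spinorPart (d : ℕ) (W : Submodule ℂ (Poly 1)) : Submodule ℂ PolySpinor :=
  Submodule.map₂ tmk (MvPolynomial.homogeneousSubmodule (Fin 2) ℂ d) W

/-- `P(S)^d = P_2^d ⊗ S`. -/
def polySpinorDeg (d : ℕ) : Submodule ℂ PolySpinor := spinorPart d ⊤

/-- The symplectic monogenics `M^d = ker F ∩ P(S)^d` of degree `d`. -/
def monogenic (q : ℂˣ) (d : ℕ) : Submodule ℂ PolySpinor :=
  LinearMap.ker (opF q) ⊓ polySpinorDeg d

/-- `M^d_+ = ker F ∩ (P_2^d ⊗ S_+)`, the monogenics of degree `d` that are even in `y`. -/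
def monogenicPlus (q : ℂˣ) (d : ℕ) : Submodule ℂ PolySpinor :=
  LinearMap.ker (opF q) ⊓ spinorPart d spinorPlus

/-- `M^d_- = ker F ∩ (P_2^d ⊗ S_-)`, the monogenics of degree `d` that are odd in `y`. -/
def monogenicMinus (q : ℂˣ) (d : ℕ) : Submodule ℂ PolySpinor :=
  LinearMap.ker (opF q) ⊓ spinorPart d spinorMinus

end QMeta

end

/-! Everything rests on two facts about the operators: `opE'` (which is E without the scalar [2]_q)
and F commute with the action of U_{q²}, and on degree d they satisfy F E' = E' F - [d+1]_{q²}
(`opF_comm_gen`, `opE'_comm_gen`, `opF_opE'`). These are identities between rational functions of q,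
checked on the monomials x_1^a x_2^b ⊗ y^c.

Monogenics. F reverses the parity of the exponent of y, so its kernel splits into an even and an odd
part. Reading F x = 0 coefficientwise shows that x is determined by its part without x_1, which has
the form x_2^d ⊗ s(y) (`eq_zero_of_coef_zero`). On that part e is multiplication by y²/[2]_q. So if
v is a monogenic whose x_1-free part is a multiple of x_2^d y^s, with s the least exponent that
occurs for this parity, then the vectors e^n v span all monogenics of this parity
(`monogenicPart_eq_span`). For even parity v = x_2^d and s = 0. For odd parity F x = 0 forces s =
2d+1, and v is an explicit sum over the monomials x_1^(d-b) x_2^b y^(2b+1). Both vectors are killed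
by f, and k acts on them by odd powers of q.

Irreducibility. For a lowest weight vector of weight l, f sends e^(n+1) v to a multiple of e^n v
which vanishes only if (l p^n)² = 1, as p is not a root of unity. For p = q² and l an odd power of q
this never happens. Hence every nonzero vector of the module generated by v leads back to v under a
power of f (`mem_of_mem_span`). So this module is simple, and it is the Verma module itself, whose
radical is zero.

Fischer decomposition. The relation between E' and F makes E'^k M^(d-k) consist of eigenvectors of
E' F, with eigenvalue minus a sum of k quantum integers. The closed form `fischerCoeff_eq` shows
that these sums are distinct for distinct k ≤ d, which gives independence, and nonzero for k > 0.
Given the decomposition in degree d, the latter makes F E' surjective there, so a vector x of degree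
d+1 can be corrected by some E' y to a monogenic. This gives spanning by induction. -/

noncomputable section

namespace QMeta

/-! ### Lowest weight modules over `U_p(sl₂)` -/

section LowestWeight

variable {p : ℂˣ} {V : Type*} [AddCommGroup V] [Module ℂ V] [Module (Uq p) V]
  [IsScalarTower ℂ (Uq p) V]

theorem Uq.mk_surjective (p : ℂˣ) : Function.Surjective (Uq.mk p) :=
  RingQuot.mkAlgHom_surjective ℂ (Rel p)

theorem Uq.mk_rel {p : ℂˣ} {x y : FreeAlgebra ℂ Gen} (h : Rel p x y) : Uq.mk p x = Uq.mk p y :=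
  RingQuot.mkAlgHom_rel ℂ h

theorem Uq.kinv_mul_k (p : ℂˣ) : Uq.gen p Gen.kinv * Uq.gen p Gen.k = 1 := by
  simpa [Uq.gen] using Uq.mk_rel (Rel.kinv_k (q := p))

theorem Uq.k_mul_e (p : ℂˣ) :
    Uq.gen p Gen.k * Uq.gen p Gen.e = (p : ℂ) ^ 2 • (Uq.gen p Gen.e * Uq.gen p Gen.k) := by
  have h : Uq.gen p Gen.k * Uq.gen p Gen.e * Uq.gen p Gen.kinv = (p : ℂ) ^ 2 • Uq.gen p Gen.e := by
    simpa only [Uq.gen, map_mul, map_smul] using Uq.mk_rel (Rel.k_e (q := p))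
  rw [← smul_mul_assoc, ← h, mul_assoc _ (Uq.gen p Gen.kinv), Uq.kinv_mul_k, mul_one]

theorem Uq.f_mul_e (p : ℂˣ) :
    Uq.gen p Gen.f * Uq.gen p Gen.e = Uq.gen p Gen.e * Uq.gen p Gen.f
      - ((p : ℂ) - (p : ℂ)⁻¹)⁻¹ • (Uq.gen p Gen.k - Uq.gen p Gen.kinv) := by
  have h : Uq.gen p Gen.e * Uq.gen p Gen.f - Uq.gen p Gen.f * Uq.gen p Gen.e
      = ((p : ℂ) - (p : ℂ)⁻¹)⁻¹ • (Uq.gen p Gen.k - Uq.gen p Gen.kinv) := by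
    simpa only [Uq.gen, map_mul, map_smul, map_sub] using Uq.mk_rel (Rel.e_f (q := p))
  rw [← h, sub_sub_cancel]

/-- A complex subspace that is stable under the generators is stable under the whole algebra. -/
theorem smul_mem_of_gen_smul_mem {W : Submodule ℂ V}
    (h : ∀ g, ∀ x ∈ W, Uq.gen p g • x ∈ W) (u : Uq p) {x : V} (hx : x ∈ W) : u • x ∈ W := by
  obtain ⟨t, rfl⟩ := Uq.mk_surjective p u
  induction t using FreeAlgebra.induction generalizing x with
  | grade0 r =>
    rw [AlgHom.commutes, algebraMap_smul]
    exact W.smul_mem r hx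
  | grade1 g => exact h g x hx
  | mul a b ha hb =>
    rw [map_mul, mul_smul]
    exact ha (hb hx)
  | add a b ha hb =>
    rw [map_add, add_smul]
    exact W.add_mem (ha hx) (hb hx)

theorem exists_restrictScalars_eq {W : Submodule ℂ V}
    (h : ∀ g, ∀ x ∈ W, Uq.gen p g • x ∈ W) :
    ∃ N : Submodule (Uq p) V, N.restrictScalars ℂ = W :=
  ⟨{ W with smul_mem' := fun u _ hx => smul_mem_of_gen_smul_mem h u hx }, rfl⟩

variable (p) in
/-- A vector killed by `f` on which `k` acts by `l`. -/
structure IsLowestWeight (l : ℂˣ) (v : V) : Prop where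
  f_smul : Uq.gen p Gen.f • v = 0
  k_smul : Uq.gen p Gen.k • v = (l : ℂ) • v

theorem gen_smul_comm (g : Gen) (c : ℂ) (x : V) : Uq.gen p g • c • x = c • Uq.gen p g • x := by
  rw [← algebraMap_smul (Uq p) c x, ← mul_smul, ← Algebra.commutes, mul_smul, algebraMap_smul]

theorem kinv_smul_of_k_smul {c : ℂ} (hc : c ≠ 0) {x : V} (h : Uq.gen p Gen.k • x = c • x) :
    Uq.gen p Gen.kinv • x = c⁻¹ • x := by
  have h1 := congrArg (fun y => c⁻¹ • Uq.gen p Gen.kinv • y) h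
  simp only [← mul_smul, Uq.kinv_mul_k, gen_smul_comm] at h1
  rw [one_smul, inv_mul_cancel₀ hc, one_smul] at h1
  exact h1.symm

/-- Minus the coefficient of `e ^ n • v` in `f • e ^ (n + 1) • v`. -/
def lowCoeff (p l : ℂˣ) (n : ℕ) : ℂ :=
  qInt p (n + 1) * (((l : ℂ) * (p : ℂ) ^ n - ((l : ℂ) * (p : ℂ) ^ n)⁻¹) / ((p : ℂ) - (p : ℂ)⁻¹))

theorem pow_sub_inv_ne_zero {p : ℂˣ} (hp : ∀ n : ℕ, 0 < n → p ^ n ≠ 1) {n : ℕ} (hn : 0 < n) :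
    (p : ℂ) ^ n - ((p : ℂ) ^ n)⁻¹ ≠ 0 := by
  intro h
  apply hp (n * 2) (by omega)
  ext
  have h0 : (p : ℂ) ^ n ≠ 0 := pow_ne_zero _ p.ne_zero
  field_simp at h
  push_cast
  rw [pow_mul]
  linear_combination h

theorem qInt_ne_zero {p : ℂˣ} (hp : ∀ n : ℕ, 0 < n → p ^ n ≠ 1) {n : ℕ} (hn : 0 < n) :
    qInt p n ≠ 0 :=
  div_ne_zero (pow_sub_inv_ne_zero hp hn) (by simpa using pow_sub_inv_ne_zero hp one_pos)

theorem lowCoeff_ne_zero {p l : ℂˣ} (hp : ∀ n : ℕ, 0 < n → p ^ n ≠ 1)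
    (hl : ∀ n : ℕ, (l * p ^ n) ^ 2 ≠ 1) (n : ℕ) : lowCoeff p l n ≠ 0 := by
  refine mul_ne_zero (qInt_ne_zero hp n.succ_pos)
    (div_ne_zero ?_ (by simpa using pow_sub_inv_ne_zero hp one_pos))
  intro h
  apply hl n
  ext
  have h0 : (l : ℂ) * (p : ℂ) ^ n ≠ 0 := mul_ne_zero l.ne_zero (pow_ne_zero _ p.ne_zero)
  push_cast
  generalize (l : ℂ) * (p : ℂ) ^ n = z at *
  field_simp at h
  linear_combination h

namespace IsLowestWeight

variable {l : ℂˣ} {v : V} (hv : IsLowestWeight p l v)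
include hv

theorem k_smul_pow (n : ℕ) : Uq.gen p Gen.k • Uq.gen p Gen.e ^ n • v
    = ((l : ℂ) * (p : ℂ) ^ (2 * n)) • Uq.gen p Gen.e ^ n • v := by
  induction n with
  | zero => simpa using hv.k_smul
  | succ n ih =>
    rw [pow_succ', mul_smul, ← mul_smul (Uq.gen p Gen.k), Uq.k_mul_e, smul_assoc, mul_smul, ih,
      gen_smul_comm, smul_smul]
    congr 1
    ring

theorem kinv_smul_pow (n : ℕ) : Uq.gen p Gen.kinv • Uq.gen p Gen.e ^ n • v
    = ((l : ℂ) * (p : ℂ) ^ (2 * n))⁻¹ • Uq.gen p Gen.e ^ n • v :=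
  kinv_smul_of_k_smul (mul_ne_zero l.ne_zero (pow_ne_zero _ p.ne_zero)) (hv.k_smul_pow n)

/-- Moving f past one factor e costs the commutator (k - k⁻¹)/(p - p⁻¹), which is a scalar on each
e^n v. The induction sums these scalars, and `lowCoeff` is the closed form of the sum. -/
theorem f_smul_pow (hp : ∀ n : ℕ, 0 < n → p ^ n ≠ 1) (n : ℕ) :
    Uq.gen p Gen.f • Uq.gen p Gen.e ^ (n + 1) • v
      = (-lowCoeff p l n) • Uq.gen p Gen.e ^ n • v := by
  have hl0 : (l : ℂ) ≠ 0 := l.ne_zero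
  have hp0 : (p : ℂ) ≠ 0 := p.ne_zero
  have hd : (p : ℂ) - (p : ℂ)⁻¹ ≠ 0 := by simpa using pow_sub_inv_ne_zero hp one_pos
  have hd' : (p : ℂ) ^ 2 - 1 ≠ 0 := fun h => hd <| by
    field_simp
    linear_combination h
  induction n with
  | zero =>
    rw [zero_add, pow_one, pow_zero, one_smul, ← mul_smul, Uq.f_mul_e, sub_smul, mul_smul,
      hv.f_smul, smul_zero, zero_sub, smul_assoc, sub_smul, hv.k_smul,
      kinv_smul_of_k_smul hl0 hv.k_smul, ← sub_smul, smul_smul, ← neg_smul]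
    congr 1
    simp only [lowCoeff, qInt, zero_add, pow_one, pow_zero, mul_one, div_self hd, one_mul]
    field_simp
  | succ n ih =>
    rw [pow_succ', mul_smul, ← mul_smul (Uq.gen p Gen.f), Uq.f_mul_e, sub_smul, mul_smul, ih,
      gen_smul_comm, ← mul_smul (Uq.gen p Gen.e), ← pow_succ', smul_assoc, sub_smul,
      hv.k_smul_pow, hv.kinv_smul_pow, ← sub_smul, smul_smul, ← sub_smul]
    congr 1
    have e1 : (p : ℂ) ^ (2 * (n + 1)) = ((p : ℂ) ^ n) ^ 2 * (p : ℂ) ^ 2 := by ring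
    have e2 : (p : ℂ) ^ (n + 1 + 1) = (p : ℂ) ^ n * (p : ℂ) ^ 2 := by ring
    have e3 : (p : ℂ) ^ (n + 1) = (p : ℂ) ^ n * (p : ℂ) := by ring
    have h0 : (p : ℂ) ^ n ≠ 0 := pow_ne_zero _ hp0
    simp only [lowCoeff, qInt, e1, e2, e3]
    generalize (p : ℂ) ^ n = z at *
    generalize (p : ℂ) = t at *
    generalize (l : ℂ) = s at *
    field_simp
    ring

theorem smul_span_mem (hp : ∀ n : ℕ, 0 < n → p ^ n ≠ 1) (u : Uq p) {x : V}
    (hx : x ∈ Submodule.span ℂ (Set.range fun n : ℕ => Uq.gen p Gen.e ^ n • v)) :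
    u • x ∈ Submodule.span ℂ (Set.range fun n : ℕ => Uq.gen p Gen.e ^ n • v) := by
  refine smul_mem_of_gen_smul_mem (fun g x hx => ?_) u hx
  have hmem : ∀ n : ℕ, Uq.gen p Gen.e ^ n • v ∈
      Submodule.span ℂ (Set.range fun n : ℕ => Uq.gen p Gen.e ^ n • v) :=
    fun n => Submodule.subset_span ⟨n, rfl⟩
  induction hx using Submodule.span_induction with
  | zero => rw [smul_zero]; exact Submodule.zero_mem _
  | add x y _ _ hx hy => rw [smul_add]; exact Submodule.add_mem _ hx hy
  | smul c x _ hx => rw [gen_smul_comm]; exact Submodule.smul_mem _ c hx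
  | mem x hx =>
    obtain ⟨n, rfl⟩ := hx
    cases g with
    | e => simpa only [← mul_smul, ← pow_succ'] using hmem (n + 1)
    | f =>
      rcases n with _ | n
      · simp only [pow_zero, one_smul, hv.f_smul]
        exact Submodule.zero_mem _
      · simp only [hv.f_smul_pow hp]
        exact Submodule.smul_mem _ _ (hmem n)
    | k => simpa only [hv.k_smul_pow] using Submodule.smul_mem _ _ (hmem n)
    | kinv => simpa only [hv.kinv_smul_pow] using Submodule.smul_mem _ _ (hmem n)

/-- The submodule generated by a lowest weight vector `v` is spanned by the vectors `e ^ n • v`. -/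
theorem restrictScalars_span (hp : ∀ n : ℕ, 0 < n → p ^ n ≠ 1) :
    (Submodule.span (Uq p) {v}).restrictScalars ℂ
      = Submodule.span ℂ (Set.range fun n : ℕ => Uq.gen p Gen.e ^ n • v) := by
  apply le_antisymm
  · intro x hx
    obtain ⟨u, rfl⟩ := Submodule.mem_span_singleton.1 hx
    exact hv.smul_span_mem hp u (Submodule.subset_span ⟨0, by simp⟩)
  · rw [Submodule.span_le]
    rintro _ ⟨n, rfl⟩
    exact Submodule.smul_mem _ _ (Submodule.mem_span_singleton_self v)

theorem f_pow_smul_pow (hp : ∀ n : ℕ, 0 < n → p ^ n ≠ 1) (n : ℕ) :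
    Uq.gen p Gen.f ^ n • Uq.gen p Gen.e ^ n • v
      = (∏ i ∈ Finset.range n, -lowCoeff p l i) • v := by
  induction n with
  | zero => simp
  | succ n ih =>
    rw [pow_succ (Uq.gen p Gen.f), mul_smul, hv.f_smul_pow hp,
      ← algebraMap_smul (Uq p) (-lowCoeff p l n), ← mul_smul, ← Algebra.commutes, mul_smul, ih,
      algebraMap_smul, smul_smul, Finset.prod_range_succ, mul_comm]

theorem f_pow_smul_pow_of_lt (hp : ∀ n : ℕ, 0 < n → p ^ n ≠ 1) {m n : ℕ} (h : m < n) :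
    Uq.gen p Gen.f ^ n • Uq.gen p Gen.e ^ m • v = 0 := by
  obtain ⟨j, rfl⟩ := Nat.exists_eq_add_of_lt h
  rw [show m + j + 1 = (j + 1) + m by ring, pow_add, mul_smul, hv.f_pow_smul_pow hp, pow_succ,
    mul_smul, gen_smul_comm, hv.f_smul, smul_zero, smul_zero]

/-- The core of irreducibility: if n is the largest exponent in x = ∑ c_i e^i v, then f^n x is a
nonzero multiple of v. It serves for V and for the Verma module alike. -/
theorem mem_of_mem_span (hp : ∀ n : ℕ, 0 < n → p ^ n ≠ 1) (hl : ∀ n : ℕ, (l * p ^ n) ^ 2 ≠ 1)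
    {N : Submodule (Uq p) V} {x : V} (hxN : x ∈ N) (hx0 : x ≠ 0)
    (hx : x ∈ Submodule.span (Uq p) {v}) : v ∈ N := by
  have key : ∀ n : ℕ, ∀ c : ℕ → ℂ,
      ∑ i ∈ Finset.range n, c i • Uq.gen p Gen.e ^ i • v ∈ N →
      ∑ i ∈ Finset.range n, c i • Uq.gen p Gen.e ^ i • v ≠ 0 → v ∈ N := by
    intro n c
    induction n with
    | zero => simp
    | succ n ih =>
      intro hN h0
      by_cases hc : c n = 0
      · rw [Finset.sum_range_succ, hc, zero_smul, add_zero] at hN h0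
        exact ih hN h0
      -- f^n annihilates e^i v for i < n, and sends e^n v to a product of nonzero factors `-lowCoeff
      -- p l i` times v.
      · have h1 := N.smul_mem (Uq.gen p Gen.f ^ n) hN
        have hcomm : ∀ (a : ℂ) (y : V), Uq.gen p Gen.f ^ n • a • y
            = a • Uq.gen p Gen.f ^ n • y := fun a y => by
          rw [← algebraMap_smul (Uq p) a y, ← mul_smul, ← Algebra.commutes, mul_smul,
            algebraMap_smul]
        rw [Finset.sum_range_succ, smul_add, Finset.smul_sum, Finset.sum_eq_zero, zero_add, hcomm,
          hv.f_pow_smul_pow hp, smul_smul] at h1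
        · refine (Submodule.smul_mem_iff (N.restrictScalars ℂ) ?_).1 h1
          exact mul_ne_zero hc (Finset.prod_ne_zero_iff.2 fun i _ =>
            neg_ne_zero.2 (lowCoeff_ne_zero hp hl i))
        · intro i hi
          rw [hcomm, hv.f_pow_smul_pow_of_lt hp (Finset.mem_range.1 hi), smul_zero]
  have hx' : x ∈ (Submodule.span (Uq p) {v}).restrictScalars ℂ := hx
  rw [hv.restrictScalars_span hp, Finsupp.mem_span_range_iff_exists_finsupp] at hx'
  obtain ⟨c, rfl⟩ := hx'
  obtain ⟨n, hn⟩ : ∃ n, c.support ⊆ Finset.range n :=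
    ⟨c.support.sup id + 1, fun i hi => Finset.mem_range.2
      (Nat.lt_succ_of_le (Finset.le_sup (f := id) hi))⟩
  rw [Finsupp.sum_of_support_subset c hn _ (by simp)] at hxN hx0
  exact key n c hxN hx0

theorem isSimpleModule_span (hp : ∀ n : ℕ, 0 < n → p ^ n ≠ 1)
    (hl : ∀ n : ℕ, (l * p ^ n) ^ 2 ≠ 1) (h0 : v ≠ 0) :
    IsSimpleModule (Uq p) (Submodule.span (Uq p) {v}) := by
  rw [isSimpleModule_iff_isAtom]
  refine ⟨by simpa using h0, fun N hN => ?_⟩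
  by_contra hne
  obtain ⟨x, hxN, hx0⟩ := Submodule.exists_mem_ne_zero_of_ne_bot hne
  refine hN.not_ge ?_
  rw [Submodule.span_singleton_le_iff_mem]
  exact hv.mem_of_mem_span hp hl hxN hx0 (hN.le hxN)

end IsLowestWeight

/-- The cyclic generator of the Verma module. -/
def vermaGen (p l : ℂˣ) : Verma p l := (vermaIdeal p l).mkQ 1

theorem smul_vermaGen {p l : ℂˣ} (u : Uq p) : u • vermaGen p l = (vermaIdeal p l).mkQ u := by
  rw [vermaGen, ← map_smul, smul_eq_mul, mul_one]

theorem span_vermaGen (p l : ℂˣ) : Submodule.span (Uq p) {vermaGen p l} = ⊤ := by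
  rw [Submodule.eq_top_iff']
  intro x
  obtain ⟨u, rfl⟩ := (vermaIdeal p l).mkQ_surjective x
  exact Submodule.mem_span_singleton.2 ⟨u, smul_vermaGen u⟩

theorem isLowestWeight_vermaGen (p l : ℂˣ) : IsLowestWeight p l (vermaGen p l) where
  f_smul := by
    rw [smul_vermaGen]
    exact (Submodule.Quotient.mk_eq_zero _).2 (Submodule.subset_span (by simp))
  k_smul := by
    rw [← algebraMap_smul (Uq p) (l : ℂ), ← sub_eq_zero, ← sub_smul, smul_vermaGen]
    exact (Submodule.Quotient.mk_eq_zero _).2 (Submodule.subset_span (by simp))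

/-- A nonzero submodule contains the cyclic generator and is therefore everything. So for these
weights L_p(l) is the Verma module. -/
theorem vermaRad_eq_bot {p l : ℂˣ} (hp : ∀ n : ℕ, 0 < n → p ^ n ≠ 1)
    (hl : ∀ n : ℕ, (l * p ^ n) ^ 2 ≠ 1) : vermaRad p l = ⊥ := by
  rw [vermaRad, sSup_eq_bot]
  intro N hN
  by_contra hne
  obtain ⟨x, hxN, hx0⟩ := Submodule.exists_mem_ne_zero_of_ne_bot hne
  apply hN
  rw [eq_top_iff, ← span_vermaGen, Submodule.span_singleton_le_iff_mem]
  exact (isLowestWeight_vermaGen p l).mem_of_mem_span hp hl hxN hx0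
    (by rw [span_vermaGen]; trivial)

/-- The homomorphism from the Verma module that sends its generator to a lowest weight vector. -/
def IsLowestWeight.vermaHom {l : ℂˣ} {v : V} (hv : IsLowestWeight p l v) :
    Verma p l →ₗ[Uq p] V :=
  (vermaIdeal p l).liftQ (LinearMap.toSpanSingleton (Uq p) V v) <| by
    rw [vermaIdeal, Submodule.span_le]
    rintro x (rfl | rfl)
    · simpa using hv.f_smul
    · simp [sub_smul, hv.k_smul]

theorem IsLowestWeight.vermaHom_gen {l : ℂˣ} {v : V} (hv : IsLowestWeight p l v) :
    hv.vermaHom (vermaGen p l) = v := by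
  simp [vermaHom, vermaGen]

/-- The map from the Verma module hits exactly the span of v, and it is injective: a nonzero kernel
would contain the generator, whose image v is not zero. -/
theorem IsLowestWeight.nonempty_span_equiv {l : ℂˣ} {v : V} (hv : IsLowestWeight p l v)
    (hp : ∀ n : ℕ, 0 < n → p ^ n ≠ 1) (hl : ∀ n : ℕ, (l * p ^ n) ^ 2 ≠ 1) (h0 : v ≠ 0) :
    Nonempty (Submodule.span (Uq p) {v} ≃ₗ[Uq p] LMod p l) := by
  have hker : LinearMap.ker hv.vermaHom = ⊥ := by
    by_contra hne
    obtain ⟨x, hxN, hx0⟩ := Submodule.exists_mem_ne_zero_of_ne_bot hne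
    have h := (isLowestWeight_vermaGen p l).mem_of_mem_span hp hl hxN hx0
      (by rw [span_vermaGen]; trivial)
    rw [LinearMap.mem_ker, hv.vermaHom_gen] at h
    exact h0 h
  have hrange : LinearMap.range hv.vermaHom = Submodule.span (Uq p) {v} := by
    rw [← Submodule.map_top, ← span_vermaGen, Submodule.map_span, Set.image_singleton,
      hv.vermaHom_gen]
  exact ⟨((Submodule.quotEquivOfEqBot _ (vermaRad_eq_bot hp hl)).trans
    ((LinearEquiv.ofInjective _ (LinearMap.ker_eq_bot.1 hker)).trans
      (LinearEquiv.ofEq _ _ hrange))).symm⟩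

end LowestWeight

/-! ### The monomial basis of `P(S)` -/

/-- The monomial `x_1^a x_2^b` of `P_2`. -/
def xMono (a b : ℕ) : Poly 2 :=
  MvPolynomial.monomial (Finsupp.single 0 a + Finsupp.single 1 b) 1

/-- The monomial `y^c` of `S`. -/
def yMono (c : ℕ) : Poly 1 := MvPolynomial.monomial (Finsupp.single 0 c) 1

/-- The monomial `x_1^a x_2^b ⊗ y^c` of `P(S)`. -/
def mono (a b c : ℕ) : PolySpinor := tmk (xMono a b) (yMono c)

/-- The exponents of the monomials of `P(S)`. -/
def expEquiv : (Fin 2 →₀ ℕ) × (Fin 1 →₀ ℕ) ≃ ℕ × ℕ × ℕ :=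
  ((Finsupp.equivFunOnFinite.trans (finTwoArrowEquiv ℕ)).prodCongr (Finsupp.uniqueEquiv 0)).trans
    (Equiv.prodAssoc ℕ ℕ ℕ)

/-- The monomial basis of `P(S)`. -/
def spinorBasis : Module.Basis (ℕ × ℕ × ℕ) ℂ PolySpinor :=
  (((MvPolynomial.basisMonomials (Fin 2) ℂ).tensorProduct
    (MvPolynomial.basisMonomials (Fin 1) ℂ)).reindex expEquiv :
      Module.Basis (ℕ × ℕ × ℕ) ℂ (Poly 2 ⊗[ℂ] Poly 1))

theorem exponent_eq (α : Fin 2 →₀ ℕ) :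
    α = Finsupp.single 0 (α 0) + Finsupp.single 1 (α 1) := by
  ext i
  fin_cases i <;> simp

theorem expEquiv_symm (a b c : ℕ) : expEquiv.symm (a, b, c)
    = (Finsupp.single 0 a + Finsupp.single 1 b, Finsupp.single 0 c) := by
  rw [Equiv.symm_apply_eq]
  simp [expEquiv]

theorem spinorBasis_apply (a b c : ℕ) : spinorBasis (a, b, c) = mono a b c := by
  have h := Module.Basis.reindex_apply ((MvPolynomial.basisMonomials (Fin 2) ℂ).tensorProduct
    (MvPolynomial.basisMonomials (Fin 1) ℂ)) expEquiv (a, b, c)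
  rw [expEquiv_symm, Module.Basis.tensorProduct_apply, MvPolynomial.coe_basisMonomials,
    MvPolynomial.coe_basisMonomials] at h
  exact h

theorem end_ext_mono {M : Type*} [AddCommGroup M] [Module ℂ M] {A B : PolySpinor →ₗ[ℂ] M}
    (h : ∀ a b c, A (mono a b c) = B (mono a b c)) : A = B :=
  spinorBasis.ext fun ⟨a, b, c⟩ => by rw [spinorBasis_apply, h]

/-- The coefficient of `x_1^a x_2^b ⊗ y^c`. -/
def coef (a b c : ℕ) : PolySpinor →ₗ[ℂ] ℂ := spinorBasis.coord (a, b, c)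

theorem coef_mono (a b c a' b' c' : ℕ) :
    coef a b c (mono a' b' c') = if a' = a ∧ b' = b ∧ c' = c then 1 else 0 := by
  rw [coef, ← spinorBasis_apply, Module.Basis.coord_apply, Module.Basis.repr_self,
    Finsupp.single_apply]
  simp

theorem eq_of_coef {x y : PolySpinor} (h : ∀ a b c, coef a b c x = coef a b c y) : x = y :=
  spinorBasis.ext_elem fun ⟨a, b, c⟩ => h a b c

theorem eq_zero_of_coef {x : PolySpinor} (h : ∀ a b c, coef a b c x = 0) : x = 0 :=
  eq_of_coef fun a b c => by rw [h, map_zero]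

/-! ### The graded pieces -/

/-- The span of the monomials of degree `d` in `x` whose exponent of `y` is in `C`. -/
def gradedPart (d : ℕ) (C : Set ℕ) : Submodule ℂ PolySpinor :=
  Submodule.span ℂ (spinorBasis '' {i | i.1 + i.2.1 = d ∧ i.2.2 ∈ C})

theorem mem_gradedPart {d : ℕ} {C : Set ℕ} {x : PolySpinor} :
    x ∈ gradedPart d C ↔ ∀ a b c, coef a b c x ≠ 0 → a + b = d ∧ c ∈ C := by
  rw [gradedPart, Module.Basis.mem_span_image]
  constructor
  · intro h a b c hx
    exact h (Finsupp.mem_support_iff.2 hx)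
  · rintro h ⟨a, b, c⟩ hx
    exact h a b c (Finsupp.mem_support_iff.1 hx)

theorem mono_mem_gradedPart {d : ℕ} {C : Set ℕ} {a b c : ℕ} (h : a + b = d) (hc : c ∈ C) :
    mono a b c ∈ gradedPart d C :=
  Submodule.subset_span ⟨(a, b, c), ⟨h, hc⟩, spinorBasis_apply a b c⟩

theorem gradedPart_induction {d : ℕ} {C : Set ℕ} {W : Submodule ℂ PolySpinor}
    {A : Module.End ℂ PolySpinor}
    (h : ∀ a b c, a + b = d → c ∈ C → A (mono a b c) ∈ W) {x : PolySpinor}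
    (hx : x ∈ gradedPart d C) : A x ∈ W := by
  have h' : gradedPart d C ≤ W.comap A := by
    rw [gradedPart, Submodule.span_le]
    rintro _ ⟨⟨a, b, c⟩, ⟨hd, hc⟩, rfl⟩
    rw [spinorBasis_apply]
    exact h a b c hd hc
  exact h' hx

theorem homogeneousSubmodule_eq_span (d : ℕ) : MvPolynomial.homogeneousSubmodule (Fin 2) ℂ d
    = Submodule.span ℂ ((fun i : ℕ × ℕ => xMono i.1 i.2) '' {i | i.1 + i.2 = d}) := by
  apply le_antisymm
  · intro p hp
    rw [MvPolynomial.mem_homogeneousSubmodule] at hp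
    rw [p.as_sum]
    refine Submodule.sum_mem _ fun α hα => ?_
    have hd : α 0 + α 1 = d := by
      have := hp (MvPolynomial.mem_support_iff.1 hα)
      simpa [Finsupp.weight_apply, Finsupp.sum_fintype] using this
    have e : MvPolynomial.monomial α (p.coeff α) = p.coeff α • xMono (α 0) (α 1) := by
      rw [xMono, ← exponent_eq, MvPolynomial.smul_monomial, smul_eq_mul, mul_one]
    rw [e]
    exact Submodule.smul_mem _ _ (Submodule.subset_span ⟨(α 0, α 1), hd, rfl⟩)
  · rw [Submodule.span_le]
    rintro _ ⟨⟨a, b⟩, h, rfl⟩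
    rw [SetLike.mem_coe, MvPolynomial.mem_homogeneousSubmodule]
    refine MvPolynomial.isHomogeneous_monomial _ ?_
    simpa [map_add, Finsupp.degree_single] using h

/-- Replaces tensor products of subspaces by coordinate subspaces. All of S and its two parity parts
are then treated at once, as choices of the set C. -/
theorem spinorPart_span (d : ℕ) (C : Set ℕ) :
    spinorPart d (Submodule.span ℂ (yMono '' C)) = gradedPart d C := by
  rw [spinorPart, homogeneousSubmodule_eq_span, Submodule.map₂_span_span, gradedPart]
  congr 1
  ext x
  constructor
  · rintro ⟨_, ⟨⟨a, b⟩, h, rfl⟩, _, ⟨c, hc, rfl⟩, rfl⟩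
    exact ⟨(a, b, c), ⟨h, hc⟩, spinorBasis_apply a b c⟩
  · rintro ⟨⟨a, b, c⟩, ⟨h, hc⟩, rfl⟩
    exact ⟨_, ⟨(a, b), h, rfl⟩, _, ⟨c, hc, rfl⟩, (spinorBasis_apply a b c).symm⟩

theorem X_pow_eq_yMono (c : ℕ) : (MvPolynomial.X 0 : Poly 1) ^ c = yMono c := by
  rw [MvPolynomial.X_pow_eq_monomial, yMono]

theorem span_yMono_univ : Submodule.span ℂ (yMono '' Set.univ) = ⊤ := by
  rw [Set.image_univ, ← (MvPolynomial.basisMonomials (Fin 1) ℂ).span_eq]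
  congr 1
  rw [MvPolynomial.coe_basisMonomials]
  ext x
  constructor
  · rintro ⟨c, rfl⟩
    exact ⟨_, rfl⟩
  · rintro ⟨α, rfl⟩
    refine ⟨α 0, ?_⟩
    exact congrArg (fun β => MvPolynomial.monomial β (1 : ℂ)) (Finsupp.unique_single α).symm

theorem polySpinorDeg_eq (d : ℕ) : polySpinorDeg d = gradedPart d Set.univ := by
  rw [polySpinorDeg, ← span_yMono_univ, spinorPart_span]

theorem spinorPart_plus (d : ℕ) : spinorPart d spinorPlus = gradedPart d {c | Even c} := by
  rw [← spinorPart_span, spinorPlus]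
  congr 2
  ext x
  constructor
  · rintro ⟨n, rfl⟩
    exact ⟨2 * n, even_two_mul n, (X_pow_eq_yMono _).symm⟩
  · rintro ⟨c, hc, rfl⟩
    obtain ⟨n, rfl⟩ := even_iff_exists_two_mul.1 hc
    exact ⟨n, X_pow_eq_yMono _⟩

theorem spinorPart_minus (d : ℕ) : spinorPart d spinorMinus = gradedPart d {c | Odd c} := by
  rw [← spinorPart_span, spinorMinus]
  congr 2
  ext x
  constructor
  · rintro ⟨n, rfl⟩
    exact ⟨2 * n + 1, odd_two_mul_add_one n, (X_pow_eq_yMono _).symm⟩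
  · rintro ⟨c, hc, rfl⟩
    obtain ⟨n, rfl⟩ := hc
    exact ⟨n, X_pow_eq_yMono _⟩

/-! ### The operators on monomials -/

theorem gam_zero_xMono (q : ℂˣ) (a b : ℕ) : gam q 0 (xMono a b) = (q : ℂ) ^ a • xMono a b := by
  rw [xMono, gam_monomial, MvPolynomial.smul_monomial]
  simp

theorem gam_one_xMono (q : ℂˣ) (a b : ℕ) : gam q 1 (xMono a b) = (q : ℂ) ^ b • xMono a b := by
  rw [xMono, gam_monomial, MvPolynomial.smul_monomial]
  simp

theorem mu_zero_xMono (a b : ℕ) : mu 0 (xMono a b) = xMono (a + 1) b := by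
  rw [xMono, mu_monomial, xMono, Finsupp.single_add]
  congr 1
  simp only [add_assoc, add_comm, add_left_comm]

theorem mu_one_xMono (a b : ℕ) : mu 1 (xMono a b) = xMono a (b + 1) := by
  rw [xMono, mu_monomial, xMono, Finsupp.single_add]
  congr 1
  simp only [add_comm, add_left_comm]

theorem qDer_zero_xMono (q : ℂˣ) (a b : ℕ) :
    qDer q 0 (xMono a b) = qInt q a • xMono (a - 1) b := by
  rw [xMono, qDer_monomial, xMono, MvPolynomial.smul_monomial]
  congr 1
  · congr 1
    ext i
    fin_cases i <;> simp
  · simp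

theorem qDer_one_xMono (q : ℂˣ) (a b : ℕ) :
    qDer q 1 (xMono a b) = qInt q b • xMono a (b - 1) := by
  rw [xMono, qDer_monomial, xMono, MvPolynomial.smul_monomial]
  congr 1
  · congr 1
    ext i
    fin_cases i <;> simp
  · simp

theorem gam_yMono (q : ℂˣ) (c : ℕ) : gam q 0 (yMono c) = (q : ℂ) ^ c • yMono c := by
  rw [yMono, gam_monomial, MvPolynomial.smul_monomial]
  simp

theorem mu_yMono (c : ℕ) : mu 0 (yMono c) = yMono (c + 1) := by
  rw [yMono, mu_monomial, yMono, Finsupp.single_add]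

theorem qDer_yMono (q : ℂˣ) (c : ℕ) : qDer q 0 (yMono c) = qInt q c • yMono (c - 1) := by
  rw [yMono, qDer_monomial, yMono, MvPolynomial.smul_monomial]
  congr 1
  · congr 1
    simp
  · simp

theorem e_mono (q : ℂˣ) (a b c : ℕ) : sigmaGen q Gen.e (mono a b c)
    = (q * (q : ℂ) ^ (2 * c) * qInt (q ^ 2) b) • mono (a + 1) (b - 1) c
      + (qInt q 2)⁻¹ • mono a b (c + 2) := by
  simp only [sigmaGen, mono, LinearMap.add_apply, tens_tmk, Ew, Ks, Es, Module.End.mul_apply,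
    pow_two (gam _ _), pow_two (mu _), LinearMap.smul_apply, qDer_one_xMono, map_smul,
    mu_zero_xMono, gam_yMono, mu_yMono, Module.End.one_apply]
  rw [smul_smul, smul_smul]
  simp only [smul_smul]
  congr 2
  ring

theorem f_mono (q : ℂˣ) (a b c : ℕ) : sigmaGen q Gen.f (mono a b c)
    = qInt (q ^ 2) a • mono (a - 1) (b + 1) c
      - (((q : ℂ) ^ (2 * a))⁻¹ * (q : ℂ) ^ (2 * b) * (qInt q 2)⁻¹ * qInt q c * qInt q (c - 1))
        • mono a b (c - 2) := by
  simp only [sigmaGen, mono, LinearMap.add_apply, tens_tmk, Fw, KwInv, Fs, Module.End.mul_apply,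
    pow_two (gam _ _), pow_two (qDer _ _), LinearMap.smul_apply, LinearMap.neg_apply,
    qDer_zero_xMono, map_smul, gam_zero_xMono, gam_one_xMono,
    mu_one_xMono, qDer_yMono, Module.End.one_apply, map_neg, sub_eq_add_neg, ← smul_neg]
  simp only [smul_neg, smul_smul, Nat.sub_sub, Units.val_inv_eq_inv_val, inv_pow,
    Nat.reduceAdd]
  congr 3
  ring

theorem k_mono (q : ℂˣ) (a b c : ℕ) : sigmaGen q Gen.k (mono a b c)
    = (q * (q : ℂ) ^ (2 * a) * ((q : ℂ) ^ (2 * b))⁻¹ * (q : ℂ) ^ (2 * c)) • mono a b c := by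
  simp only [sigmaGen, mono, tens_tmk, Kw, Ks, Module.End.mul_apply, pow_two (gam _ _),
    LinearMap.smul_apply, map_smul, gam_zero_xMono, gam_one_xMono, gam_yMono]
  simp only [smul_smul, Units.val_inv_eq_inv_val, inv_pow]
  congr 1
  ring

theorem kinv_mono (q : ℂˣ) (a b c : ℕ) : sigmaGen q Gen.kinv (mono a b c)
    = (q * (q : ℂ) ^ (2 * a) * ((q : ℂ) ^ (2 * b))⁻¹ * (q : ℂ) ^ (2 * c))⁻¹ • mono a b c := by
  simp only [sigmaGen, mono, tens_tmk, KwInv, KsInv, Module.End.mul_apply, pow_two (gam _ _),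
    LinearMap.smul_apply, map_smul, gam_zero_xMono, gam_one_xMono, gam_yMono]
  simp only [smul_smul, Units.val_inv_eq_inv_val, inv_pow, mul_inv, inv_inv]
  congr 1
  ring

/-- The raising operator without its scalar factor, `q² γ_2² ω μ_1 ∇ + μ_2 ν`. -/
def opE' (q : ℂˣ) : Module.End ℂ PolySpinor :=
  (q : ℂ) ^ 2 • tens (gam q 1 ^ 2 * mu 0) (gam q 0 * qDer q 0) + tens (mu 1) (mu 0)

theorem opE_eq (q : ℂˣ) : opE q = qInt q 2 • opE' q := rfl

theorem opE'_mono (q : ℂˣ) (a b c : ℕ) : opE' q (mono a b c)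
    = ((q : ℂ) ^ 2 * (q : ℂ) ^ (2 * b) * (q : ℂ) ^ (c - 1) * qInt q c) • mono (a + 1) b (c - 1)
      + mono a (b + 1) (c + 1) := by
  simp only [opE', mono, LinearMap.add_apply, tens_tmk, Module.End.mul_apply,
    pow_two (gam _ _), LinearMap.smul_apply, map_smul, gam_one_xMono, gam_yMono,
    mu_zero_xMono, mu_one_xMono, qDer_yMono, mu_yMono]
  simp only [smul_smul]
  congr 2
  ring

theorem opF_mono (q : ℂˣ) (a b c : ℕ) : opF q (mono a b c)
    = qInt (q ^ 2) a • mono (a - 1) b (c + 1)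
      - (((q : ℂ) ^ (2 * a))⁻¹ * (q : ℂ) ^ (c - 1) * qInt (q ^ 2) b * qInt q c)
        • mono a (b - 1) (c - 1) := by
  simp only [opF, mono, LinearMap.sub_apply, tens_tmk, Module.End.mul_apply,
    pow_two (gam _ _), LinearMap.smul_apply, map_smul, gam_zero_xMono, gam_yMono,
    qDer_zero_xMono, qDer_one_xMono, qDer_yMono, mu_yMono]
  simp only [smul_smul, Units.val_inv_eq_inv_val, inv_pow]
  congr 2
  ring

/-! ### Commutation relations -/

section Commutation

set_option linter.unusedSimpArgs false

theorem pow_sub_one_ne_zero {q : ℂˣ} (hq : ∀ n : ℕ, 0 < n → q ^ n ≠ 1) {n : ℕ} (hn : 0 < n) :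
    (q : ℂ) ^ n - 1 ≠ 0 := fun h => hq n hn <| by
  ext
  push_cast
  linear_combination h

theorem sq_add_one_ne_zero {q : ℂˣ} (hq : ∀ n : ℕ, 0 < n → q ^ n ≠ 1) : (q : ℂ) ^ 2 + 1 ≠ 0 :=
  fun h => pow_sub_one_ne_zero hq (n := 4) (by norm_num)
    (by linear_combination ((q : ℂ) ^ 2 - 1) * h)

/-- With [n]_q as a rational function of the single quantity q^n, the commutation relations become
field identities. If q² = 1, both sides are 0 by the convention on division. -/
theorem qInt_eq (q : ℂˣ) (n : ℕ) :
    qInt q n = q * (((q : ℂ) ^ n) ^ 2 - 1) / ((q : ℂ) ^ n * ((q : ℂ) ^ 2 - 1)) := by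
  have h0 : (q : ℂ) ≠ 0 := q.ne_zero
  have hn : (q : ℂ) ^ n ≠ 0 := pow_ne_zero _ h0
  have e : (q : ℂ) - (q : ℂ)⁻¹ = ((q : ℂ) ^ 2 - 1) / q := by field_simp
  rw [qInt, e, div_div_eq_mul_div, mul_comm ((q : ℂ) ^ n), ← div_div]
  rw [div_right_comm]
  congr 1
  field_simp

theorem qInt_sq_eq (q : ℂˣ) (n : ℕ) : qInt (q ^ 2) n
    = (q : ℂ) ^ 2 * (((q : ℂ) ^ n) ^ 4 - 1)
      / (((q : ℂ) ^ n) ^ 2 * (((q : ℂ) ^ 2 - 1) * ((q : ℂ) ^ 2 + 1))) := by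
  rw [qInt_eq]
  push_cast
  congr 1 <;> ring

theorem qInt_two_inv {q : ℂˣ} (hq : ∀ n : ℕ, 0 < n → q ^ n ≠ 1) :
    (qInt q 2)⁻¹ = q / ((q : ℂ) ^ 2 + 1) := by
  have h0 : (q : ℂ) ≠ 0 := q.ne_zero
  have h1 := pow_sub_one_ne_zero hq (n := 2) (by norm_num)
  have h2 := sq_add_one_ne_zero hq
  rw [qInt_eq, inv_div, div_eq_div_iff]
  · ring
  · refine mul_ne_zero h0 ?_
    rw [← pow_mul]
    exact pow_sub_one_ne_zero hq (n := 4) (by norm_num)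
  · exact h2

/-- Both composites are expanded on monomials and their coefficients compared. The only denominators
are powers of q and the factors q² - 1 and q² + 1, nonzero because q is not a root of unity. The
commutation lemmas that follow use the same computation. -/
theorem opF_comm_e {q : ℂˣ} (hq : ∀ n : ℕ, 0 < n → q ^ n ≠ 1) :
    opF q ∘ₗ sigmaGen q Gen.e = sigmaGen q Gen.e ∘ₗ opF q := by
  have h0 : (q : ℂ) ≠ 0 := q.ne_zero
  have h1 := pow_sub_one_ne_zero hq (n := 2) (by norm_num)
  have h2 := sq_add_one_ne_zero hq
  refine end_ext_mono fun a b c => ?_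
  simp only [LinearMap.comp_apply, e_mono, opF_mono, map_sub, map_add, map_smul, qInt_two_inv hq]
  rcases a with _ | a <;> rcases b with _ | b <;> rcases c with _ | _ | _ | c <;>
  simp only [qInt_zero, zero_smul, mul_zero, zero_mul, Nat.zero_sub, Nat.reduceSubDiff,
    Nat.sub_self, zero_add, smul_zero, sub_zero, add_zero, Nat.reduceAdd, add_assoc, smul_sub,
    smul_add, smul_smul, zero_sub, smul_neg] <;>
  match_scalars <;>
  (try simp only [qInt_sq_eq]) <;>
  (try simp only [qInt_eq, pow_add, mul_add, pow_mul', pow_zero, pow_one, mul_zero, mul_one,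
    inv_one]) <;>
  field_simp <;> ring

theorem opF_comm_f {q : ℂˣ} (hq : ∀ n : ℕ, 0 < n → q ^ n ≠ 1) :
    opF q ∘ₗ sigmaGen q Gen.f = sigmaGen q Gen.f ∘ₗ opF q := by
  have h0 : (q : ℂ) ≠ 0 := q.ne_zero
  have h1 := pow_sub_one_ne_zero hq (n := 2) (by norm_num)
  have h2 := sq_add_one_ne_zero hq
  refine end_ext_mono fun a b c => ?_
  simp only [LinearMap.comp_apply, f_mono, opF_mono, map_sub, map_add, map_smul, qInt_two_inv hq]
  -- Exponents are subtracted with truncation at 0. As f and F together lower c by as much as 3, the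
  -- values c = 0, 1, 2 are separated; there the truncated terms carry a factor [0] = 0.
  rcases a with _ | a <;> rcases b with _ | b <;> rcases c with _ | _ | _ | c <;>
  simp only [qInt_zero, zero_smul, mul_zero, zero_mul, Nat.zero_sub, Nat.reduceSubDiff,
    Nat.sub_self, zero_add, smul_zero, sub_zero, add_zero, Nat.reduceAdd, add_assoc, smul_sub,
    smul_add, smul_smul, zero_sub, smul_neg] <;>
  match_scalars <;>
  (try simp only [qInt_sq_eq]) <;>
  (try simp only [qInt_eq, pow_add, mul_add, pow_mul', pow_zero, pow_one, mul_zero, mul_one,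
    inv_one]) <;>
  field_simp <;> ring

theorem opF_comm_k {q : ℂˣ} (hq : ∀ n : ℕ, 0 < n → q ^ n ≠ 1) :
    opF q ∘ₗ sigmaGen q Gen.k = sigmaGen q Gen.k ∘ₗ opF q := by
  have h0 : (q : ℂ) ≠ 0 := q.ne_zero
  have h1 := pow_sub_one_ne_zero hq (n := 2) (by norm_num)
  have h2 := sq_add_one_ne_zero hq
  refine end_ext_mono fun a b c => ?_
  simp only [LinearMap.comp_apply, k_mono, opF_mono, map_sub, map_add, map_smul, qInt_two_inv hq]
  rcases a with _ | a <;> rcases b with _ | b <;> rcases c with _ | _ | _ | c <;>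
  simp only [qInt_zero, zero_smul, mul_zero, zero_mul, Nat.zero_sub, Nat.reduceSubDiff,
    Nat.sub_self, zero_add, smul_zero, sub_zero, add_zero, Nat.reduceAdd, add_assoc, smul_sub,
    smul_add, smul_smul, zero_sub, smul_neg] <;>
  match_scalars <;>
  (try simp only [qInt_sq_eq]) <;>
  (try simp only [qInt_eq, pow_add, mul_add, pow_mul', pow_zero, pow_one, mul_zero, mul_one,
    inv_one]) <;>
  field_simp

theorem opF_comm_kinv {q : ℂˣ} (hq : ∀ n : ℕ, 0 < n → q ^ n ≠ 1) :
    opF q ∘ₗ sigmaGen q Gen.kinv = sigmaGen q Gen.kinv ∘ₗ opF q := by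
  have h0 : (q : ℂ) ≠ 0 := q.ne_zero
  have h1 := pow_sub_one_ne_zero hq (n := 2) (by norm_num)
  have h2 := sq_add_one_ne_zero hq
  refine end_ext_mono fun a b c => ?_
  simp only [LinearMap.comp_apply, kinv_mono, opF_mono, map_sub, map_add, map_smul, qInt_two_inv hq]
  rcases a with _ | a <;> rcases b with _ | b <;> rcases c with _ | _ | _ | c <;>
  simp only [qInt_zero, zero_smul, mul_zero, zero_mul, Nat.zero_sub, Nat.reduceSubDiff,
    Nat.sub_self, zero_add, smul_zero, sub_zero, add_zero, Nat.reduceAdd, add_assoc, smul_sub,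
    smul_add, smul_smul, zero_sub, smul_neg] <;>
  match_scalars <;>
  (try simp only [qInt_sq_eq]) <;>
  (try simp only [qInt_eq, pow_add, mul_add, pow_mul', pow_zero, pow_one, mul_zero, mul_one,
    inv_one]) <;>
  field_simp

theorem opE'_comm_e {q : ℂˣ} (hq : ∀ n : ℕ, 0 < n → q ^ n ≠ 1) :
    opE' q ∘ₗ sigmaGen q Gen.e = sigmaGen q Gen.e ∘ₗ opE' q := by
  have h0 : (q : ℂ) ≠ 0 := q.ne_zero
  have h1 := pow_sub_one_ne_zero hq (n := 2) (by norm_num)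
  have h2 := sq_add_one_ne_zero hq
  refine end_ext_mono fun a b c => ?_
  simp only [LinearMap.comp_apply, e_mono, opE'_mono, map_sub, map_add, map_smul, qInt_two_inv hq]
  rcases a with _ | a <;> rcases b with _ | b <;> rcases c with _ | _ | _ | c <;>
  simp only [qInt_zero, zero_smul, mul_zero, zero_mul, Nat.zero_sub, Nat.reduceSubDiff,
    Nat.sub_self, zero_add, smul_zero, sub_zero, add_zero, Nat.reduceAdd, add_assoc, smul_sub,
    smul_add, smul_smul, zero_sub, smul_neg] <;>
  match_scalars <;>
  (try simp only [qInt_sq_eq]) <;>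
  (try simp only [qInt_eq, pow_add, mul_add, pow_mul', pow_zero, pow_one, mul_zero, mul_one,
    inv_one]) <;>
  field_simp <;> ring

theorem opE'_comm_f {q : ℂˣ} (hq : ∀ n : ℕ, 0 < n → q ^ n ≠ 1) :
    opE' q ∘ₗ sigmaGen q Gen.f = sigmaGen q Gen.f ∘ₗ opE' q := by
  have h0 : (q : ℂ) ≠ 0 := q.ne_zero
  have h1 := pow_sub_one_ne_zero hq (n := 2) (by norm_num)
  have h2 := sq_add_one_ne_zero hq
  refine end_ext_mono fun a b c => ?_
  simp only [LinearMap.comp_apply, f_mono, opE'_mono, map_sub, map_add, map_smul, qInt_two_inv hq]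
  rcases a with _ | a <;> rcases b with _ | b <;> rcases c with _ | _ | _ | c <;>
  simp only [qInt_zero, zero_smul, mul_zero, zero_mul, Nat.zero_sub, Nat.reduceSubDiff,
    Nat.sub_self, zero_add, smul_zero, sub_zero, add_zero, Nat.reduceAdd, add_assoc, smul_sub,
    smul_add, smul_smul, zero_sub, smul_neg] <;>
  match_scalars <;>
  (try simp only [qInt_sq_eq]) <;>
  (try simp only [qInt_eq, pow_add, mul_add, pow_mul', pow_zero, pow_one, mul_zero, mul_one,
    inv_one]) <;>
  field_simp <;> ring

theorem opE'_comm_k {q : ℂˣ} (hq : ∀ n : ℕ, 0 < n → q ^ n ≠ 1) :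
    opE' q ∘ₗ sigmaGen q Gen.k = sigmaGen q Gen.k ∘ₗ opE' q := by
  have h0 : (q : ℂ) ≠ 0 := q.ne_zero
  have h1 := pow_sub_one_ne_zero hq (n := 2) (by norm_num)
  have h2 := sq_add_one_ne_zero hq
  refine end_ext_mono fun a b c => ?_
  simp only [LinearMap.comp_apply, k_mono, opE'_mono, map_sub, map_add, map_smul, qInt_two_inv hq]
  rcases a with _ | a <;> rcases b with _ | b <;> rcases c with _ | _ | _ | c <;>
  simp only [qInt_zero, zero_smul, mul_zero, zero_mul, Nat.zero_sub, Nat.reduceSubDiff,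
    Nat.sub_self, zero_add, smul_zero, sub_zero, add_zero, Nat.reduceAdd, add_assoc, smul_sub,
    smul_add, smul_smul, zero_sub, smul_neg] <;>
  match_scalars <;>
  (try simp only [qInt_eq, pow_add, mul_add, pow_mul', pow_zero, pow_one, mul_zero, mul_one,
    inv_one]) <;>
  field_simp

theorem opE'_comm_kinv {q : ℂˣ} (hq : ∀ n : ℕ, 0 < n → q ^ n ≠ 1) :
    opE' q ∘ₗ sigmaGen q Gen.kinv = sigmaGen q Gen.kinv ∘ₗ opE' q := by
  have h0 : (q : ℂ) ≠ 0 := q.ne_zero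
  have h1 := pow_sub_one_ne_zero hq (n := 2) (by norm_num)
  have h2 := sq_add_one_ne_zero hq
  refine end_ext_mono fun a b c => ?_
  simp only [LinearMap.comp_apply, kinv_mono, opE'_mono, map_sub, map_add, map_smul, qInt_two_inv hq]
  rcases a with _ | a <;> rcases b with _ | b <;> rcases c with _ | _ | _ | c <;>
  simp only [qInt_zero, zero_smul, mul_zero, zero_mul, Nat.zero_sub, Nat.reduceSubDiff,
    Nat.sub_self, zero_add, smul_zero, sub_zero, add_zero, Nat.reduceAdd, add_assoc, smul_sub,
    smul_add, smul_smul, zero_sub, smul_neg] <;>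
  match_scalars <;>
  (try simp only [qInt_eq, pow_add, mul_add, pow_mul', pow_zero, pow_one, mul_zero, mul_one,
    inv_one]) <;>
  field_simp

/-- The relation that drives the Fischer decomposition. The commutator of E' and F is a scalar
depending only on the degree a + b in x, not on c. -/
theorem opF_opE'_mono {q : ℂˣ} (hq : ∀ n : ℕ, 0 < n → q ^ n ≠ 1) (a b c : ℕ) :
    opF q (opE' q (mono a b c))
      = opE' q (opF q (mono a b c)) - qInt (q ^ 2) (a + b + 1) • mono a b c := by
  have h0 : (q : ℂ) ≠ 0 := q.ne_zero
  have h1 := pow_sub_one_ne_zero hq (n := 2) (by norm_num)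
  have h2 := sq_add_one_ne_zero hq
  simp only [opF_mono, opE'_mono, map_sub, map_add, map_smul]
  rcases a with _ | a <;> rcases b with _ | b <;> rcases c with _ | _ | _ | c <;>
  simp only [qInt_zero, zero_smul, mul_zero, zero_mul, Nat.zero_sub, Nat.reduceSubDiff,
    Nat.sub_self, zero_add, smul_zero, sub_zero, add_zero, Nat.reduceAdd, add_assoc, smul_sub,
    smul_add, smul_smul, zero_sub, smul_neg] <;>
  match_scalars <;>
  (try simp only [qInt_sq_eq]) <;>
  (try simp only [qInt_eq, pow_add, mul_add, pow_mul', pow_zero, pow_one, mul_zero, mul_one,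
    inv_one]) <;>
  field_simp <;> ring

end Commutation

theorem opF_comm_gen {q : ℂˣ} (hq : ∀ n : ℕ, 0 < n → q ^ n ≠ 1) (g : Gen) (x : PolySpinor) :
    opF q (sigmaGen q g x) = sigmaGen q g (opF q x) := by
  cases g with
  | e => exact LinearMap.congr_fun (opF_comm_e hq) x
  | f => exact LinearMap.congr_fun (opF_comm_f hq) x
  | k => exact LinearMap.congr_fun (opF_comm_k hq) x
  | kinv => exact LinearMap.congr_fun (opF_comm_kinv hq) x

theorem opE'_comm_gen {q : ℂˣ} (hq : ∀ n : ℕ, 0 < n → q ^ n ≠ 1) (g : Gen) (x : PolySpinor) :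
    opE' q (sigmaGen q g x) = sigmaGen q g (opE' q x) := by
  cases g with
  | e => exact LinearMap.congr_fun (opE'_comm_e hq) x
  | f => exact LinearMap.congr_fun (opE'_comm_f hq) x
  | k => exact LinearMap.congr_fun (opE'_comm_k hq) x
  | kinv => exact LinearMap.congr_fun (opE'_comm_kinv hq) x

theorem opE'_pow_comm_gen {q : ℂˣ} (hq : ∀ n : ℕ, 0 < n → q ^ n ≠ 1) (g : Gen) (k : ℕ)
    (x : PolySpinor) : (opE' q ^ k) (sigmaGen q g x) = sigmaGen q g ((opE' q ^ k) x) := by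
  induction k with
  | zero => rfl
  | succ k ih => rw [pow_succ', Module.End.mul_apply, ih, opE'_comm_gen hq, Module.End.mul_apply]

/-! ### Stability of the graded pieces -/

theorem gradedPart_mono {d : ℕ} {C C' : Set ℕ} (h : C ⊆ C') : gradedPart d C ≤ gradedPart d C' :=
  fun _ hx => mem_gradedPart.2 fun a b c hc =>
    ⟨(mem_gradedPart.1 hx a b c hc).1, h (mem_gradedPart.1 hx a b c hc).2⟩

/-- The generators preserve the degree in x and change the exponent of y by 0 or ±2, hence the
condition on C. -/
theorem gen_mem_gradedPart {q : ℂˣ} {d : ℕ} {C : Set ℕ} (hC : ∀ c, c + 2 ∈ C ↔ c ∈ C) (g : Gen)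
    {x : PolySpinor} (hx : x ∈ gradedPart d C) : sigmaGen q g x ∈ gradedPart d C := by
  refine gradedPart_induction (fun a b c hd hc => ?_) hx
  cases g with
  | e =>
    rw [e_mono]
    refine Submodule.add_mem _ ?_ (Submodule.smul_mem _ _
      (mono_mem_gradedPart hd ((hC c).2 hc)))
    rcases b with _ | b
    · simp [qInt_zero]
    · exact Submodule.smul_mem _ _ (mono_mem_gradedPart (by omega) hc)
  | f =>
    rw [f_mono]
    refine Submodule.sub_mem _ ?_ ?_
    · rcases a with _ | a
      · simp [qInt_zero]
      · exact Submodule.smul_mem _ _ (mono_mem_gradedPart (by omega) hc)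
    · rcases c with _ | _ | c
      · simp [qInt_zero]
      · simp [qInt_zero]
      · exact Submodule.smul_mem _ _ (mono_mem_gradedPart hd ((hC c).1 hc))
  | k =>
    rw [k_mono]
    exact Submodule.smul_mem _ _ (mono_mem_gradedPart hd hc)
  | kinv =>
    rw [kinv_mono]
    exact Submodule.smul_mem _ _ (mono_mem_gradedPart hd hc)

/-- F changes the exponent of y by ±1. The truncated d - 1 is harmless: in degree 0 both terms of F
vanish. -/
theorem opF_mem_gradedPart {q : ℂˣ} {d : ℕ} (C C' : Set ℕ) (h1 : ∀ c ∈ C, c + 1 ∈ C')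
    (h2 : ∀ c, c + 1 ∈ C → c ∈ C') {x : PolySpinor} (hx : x ∈ gradedPart d C) :
    opF q x ∈ gradedPart (d - 1) C' := by
  refine gradedPart_induction (fun a b c hd hc => ?_) hx
  rw [opF_mono]
  refine Submodule.sub_mem _ ?_ ?_
  · rcases a with _ | a
    · simp [qInt_zero]
    · exact Submodule.smul_mem _ _ (mono_mem_gradedPart (by omega) (h1 c hc))
  · rcases b with _ | b
    · simp [qInt_zero]
    rcases c with _ | c
    · simp [qInt_zero]
    exact Submodule.smul_mem _ _ (mono_mem_gradedPart (by omega) (h2 c hc))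

theorem opF_eq_zero_of_degree_zero {q : ℂˣ} {C : Set ℕ} {x : PolySpinor}
    (hx : x ∈ gradedPart 0 C) : opF q x = 0 := by
  refine (Submodule.mem_bot ℂ).1 (gradedPart_induction (fun a b c hd hc => ?_) hx)
  obtain ⟨rfl, rfl⟩ : a = 0 ∧ b = 0 := by omega
  simp [opF_mono, qInt_zero]

theorem opE'_mem_gradedPart {q : ℂˣ} {d : ℕ} {x : PolySpinor}
    (hx : x ∈ gradedPart d Set.univ) : opE' q x ∈ gradedPart (d + 1) Set.univ := by
  refine gradedPart_induction (fun a b c hd hc => ?_) hx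
  rw [opE'_mono]
  exact Submodule.add_mem _
    (Submodule.smul_mem _ _ (mono_mem_gradedPart (by omega) trivial))
    (mono_mem_gradedPart (by omega) trivial)

theorem opE'_pow_mem_gradedPart {q : ℂˣ} {d : ℕ} (k : ℕ) {x : PolySpinor}
    (hx : x ∈ gradedPart d Set.univ) : (opE' q ^ k) x ∈ gradedPart (d + k) Set.univ := by
  induction k with
  | zero => exact hx
  | succ k ih =>
    rw [pow_succ', Module.End.mul_apply]
    exact opE'_mem_gradedPart ih

theorem opF_opE' {q : ℂˣ} (hq : ∀ n : ℕ, 0 < n → q ^ n ≠ 1) {d : ℕ} {x : PolySpinor}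
    (hx : x ∈ gradedPart d Set.univ) :
    opF q (opE' q x) = opE' q (opF q x) - qInt (q ^ 2) (d + 1) • x := by
  have h := gradedPart_induction (W := ⊥)
    (A := opF q ∘ₗ opE' q - opE' q ∘ₗ opF q + qInt (q ^ 2) (d + 1) • 1)
    (fun a b c hd _ => ?_) hx
  · rw [Submodule.mem_bot] at h
    simp only [LinearMap.add_apply, LinearMap.sub_apply, LinearMap.comp_apply,
      LinearMap.smul_apply, Module.End.one_apply] at h
    rw [← sub_eq_zero, ← h]
    abel
  · rw [Submodule.mem_bot, LinearMap.add_apply, LinearMap.sub_apply, LinearMap.comp_apply,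
      LinearMap.comp_apply, opF_opE'_mono hq, hd, LinearMap.smul_apply, Module.End.one_apply]
    abel

/-! ### Coefficients -/

theorem coef_opF_succ (q : ℂˣ) (a b c : ℕ) (x : PolySpinor) : coef a b (c + 1) (opF q x)
    = qInt (q ^ 2) (a + 1) * coef (a + 1) b c x
      - ((q : ℂ) ^ (2 * a))⁻¹ * (q : ℂ) ^ (c + 1) * qInt (q ^ 2) (b + 1) * qInt q (c + 2)
        * coef a (b + 1) (c + 2) x := by
  have h : coef a b (c + 1) ∘ₗ opF q = qInt (q ^ 2) (a + 1) • coef (a + 1) b c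
      - (((q : ℂ) ^ (2 * a))⁻¹ * (q : ℂ) ^ (c + 1) * qInt (q ^ 2) (b + 1) * qInt q (c + 2))
        • coef a (b + 1) (c + 2) := by
    refine end_ext_mono fun a' b' c' => ?_
    simp only [LinearMap.comp_apply, opF_mono, LinearMap.sub_apply, LinearMap.smul_apply, map_sub,
      map_smul, coef_mono, smul_eq_mul]
    congr 1
    · rcases a' with _ | a'
      · simp [qInt_zero]
      · simp only [Nat.add_sub_cancel, Nat.add_right_cancel_iff]
        split_ifs with h
        · rw [h.1]
        · simp
    · rcases b' with _ | b'
      · simp [qInt_zero]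
      rcases c' with _ | c'
      · simp [qInt_zero]
      simp only [Nat.add_sub_cancel, Nat.add_right_cancel_iff, show c + 2 = c + 1 + 1 from rfl]
      split_ifs with h
      · rw [h.1, h.2.1, h.2.2]
      · simp
  exact LinearMap.congr_fun h x

theorem coef_opF_zero (q : ℂˣ) (a b : ℕ) (x : PolySpinor) : coef a b 0 (opF q x)
    = -(((q : ℂ) ^ (2 * a))⁻¹ * qInt (q ^ 2) (b + 1) * qInt q 1 * coef a (b + 1) 1 x) := by
  have h : coef a b 0 ∘ₗ opF q
      = -((((q : ℂ) ^ (2 * a))⁻¹ * qInt (q ^ 2) (b + 1) * qInt q 1) • coef a (b + 1) 1) := by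
    refine end_ext_mono fun a' b' c' => ?_
    simp only [LinearMap.comp_apply, opF_mono, LinearMap.neg_apply, LinearMap.smul_apply, map_sub,
      map_smul, coef_mono, smul_eq_mul]
    rcases b' with _ | b'
    · simp [qInt_zero]
    rcases c' with _ | c'
    · simp [qInt_zero]
    rw [if_neg (show ¬(a' - 1 = a ∧ b' + 1 = b ∧ c' + 1 + 1 = 0) by omega)]
    simp only [Nat.add_sub_cancel, Nat.add_right_cancel_iff, Nat.add_eq_right]
    split_ifs with h
    · obtain ⟨rfl, rfl, rfl⟩ := h
      simp
    · simp
  exact LinearMap.congr_fun h x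

/-- The other term of e always produces a factor x_1, so modulo x_1 only the shift by y² survives.
-/
theorem coef_e_add_two (q : ℂˣ) (b c : ℕ) (x : PolySpinor) :
    coef 0 b (c + 2) (sigmaGen q Gen.e x) = (qInt q 2)⁻¹ * coef 0 b c x := by
  have h : coef 0 b (c + 2) ∘ₗ sigmaGen q Gen.e = (qInt q 2)⁻¹ • coef 0 b c := by
    refine end_ext_mono fun a' b' c' => ?_
    simp [e_mono, coef_mono]
  exact LinearMap.congr_fun h x

theorem coef_e_of_lt_two (q : ℂˣ) {b c : ℕ} (hc : c < 2) (x : PolySpinor) :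
    coef 0 b c (sigmaGen q Gen.e x) = 0 := by
  have h : coef 0 b c ∘ₗ sigmaGen q Gen.e = 0 := by
    refine end_ext_mono fun a' b' c' => ?_
    have : c' + 2 ≠ c := by omega
    simp [e_mono, coef_mono, this]
  exact LinearMap.congr_fun h x

/-! ### Monogenics -/

theorem sq_pow_ne_one {q : ℂˣ} (hq : ∀ n : ℕ, 0 < n → q ^ n ≠ 1) (n : ℕ) (hn : 0 < n) :
    (q ^ 2) ^ n ≠ 1 := by
  rw [← pow_mul]
  exact hq _ (by omega)

/-- The monogenics of degree `d` whose exponents of `y` are in `C`. -/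
def monogenicPart (q : ℂˣ) (d : ℕ) (C : Set ℕ) : Submodule ℂ PolySpinor :=
  LinearMap.ker (opF q) ⊓ gradedPart d C

theorem monogenic_eq (q : ℂˣ) (d : ℕ) : monogenic q d = monogenicPart q d Set.univ := by
  rw [monogenic, polySpinorDeg_eq, monogenicPart]

theorem monogenicPlus_eq (q : ℂˣ) (d : ℕ) :
    monogenicPlus q d = monogenicPart q d {c | Even c} := by
  rw [monogenicPlus, spinorPart_plus, monogenicPart]

theorem monogenicMinus_eq (q : ℂˣ) (d : ℕ) :
    monogenicMinus q d = monogenicPart q d {c | Odd c} := by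
  rw [monogenicMinus, spinorPart_minus, monogenicPart]

theorem gen_mem_monogenicPart {q : ℂˣ} (hq : ∀ n : ℕ, 0 < n → q ^ n ≠ 1) {d : ℕ} {C : Set ℕ}
    (hC : ∀ c, c + 2 ∈ C ↔ c ∈ C) (g : Gen) {x : PolySpinor} (hx : x ∈ monogenicPart q d C) :
    sigmaGen q g x ∈ monogenicPart q d C := by
  refine ⟨?_, gen_mem_gradedPart hC g hx.2⟩
  have hF : opF q x = 0 := hx.1
  change opF q (sigmaGen q g x) = 0
  rw [opF_comm_gen hq, hF, map_zero]

/-- A monogenic is determined by its coefficients at the monomials without `x_1`. -/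
theorem eq_zero_of_coef_zero {q : ℂˣ} (hq : ∀ n : ℕ, 0 < n → q ^ n ≠ 1) {x : PolySpinor}
    (hx : opF q x = 0) (h : ∀ b c, coef 0 b c x = 0) : x = 0 := by
  refine eq_zero_of_coef fun a => ?_
  induction a with
  | zero => exact h
  | succ a ih =>
    intro b c
    -- F x = 0 expresses [a+1] times a coefficient at x_1^(a+1) through one at x_1^a.
    have h1 := coef_opF_succ q a b c x
    rw [hx, map_zero, ih, mul_zero, sub_zero] at h1
    exact (mul_eq_zero.1 h1.symm).resolve_left (qInt_ne_zero (sq_pow_ne_one hq) a.succ_pos)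

/-- F x = 0 ties the coefficient at (a, b+1, c+2) to the one at (a+1, b, c). Descending along this
chain from c < 2b+1 reaches c = 1 with b > 0, where the constant term in y of F x kills the
coefficient. -/
theorem coef_eq_zero_of_odd {q : ℂˣ} (hq : ∀ n : ℕ, 0 < n → q ^ n ≠ 1) {d : ℕ} {x : PolySpinor}
    (hx : x ∈ monogenicPart q d {c | Odd c}) (a b c : ℕ) (hc : c < 2 * b + 1) :
    coef a b c x = 0 := by
  by_contra hne
  have hodd : Odd c := (mem_gradedPart.1 hx.2 a b c hne).2
  have hF : opF q x = 0 := hx.1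
  have hpow : ∀ n : ℕ, (q : ℂ) ^ n ≠ 0 := fun n => pow_ne_zero _ q.ne_zero
  induction b generalizing a c with
  | zero =>
    obtain rfl : c = 0 := by omega
    exact absurd hodd (by decide)
  | succ b ih =>
    have hb := qInt_ne_zero (sq_pow_ne_one hq) b.succ_pos
    rcases c with _ | _ | c
    · exact absurd hodd (by decide)
    · have h1 := coef_opF_zero q a b x
      rw [hF, map_zero, zero_eq_neg] at h1
      refine mul_ne_zero (mul_ne_zero (mul_ne_zero (inv_ne_zero (hpow _)) hb) ?_) hne h1
      exact qInt_ne_zero hq one_pos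
    · have h1 := coef_opF_succ q a b c x
      have h2 : coef (a + 1) b c x = 0 := by
        by_contra h3
        exact ih (a + 1) c (by omega) h3 (by simpa [Nat.odd_add] using hodd)
      rw [hF, map_zero, h2, mul_zero, zero_sub, zero_eq_neg] at h1
      refine mul_ne_zero (mul_ne_zero (mul_ne_zero (mul_ne_zero (inv_ne_zero (hpow _)) (hpow _))
        hb) ?_) hne h1
      exact qInt_ne_zero hq (by omega)

theorem sigmaGen_e_pow_smul (q : ℂˣ) (n : ℕ) (v : PolySpinor) :
    Uq.gen (q ^ 2) Gen.e ^ (n + 1) • v = sigmaGen q Gen.e (Uq.gen (q ^ 2) Gen.e ^ n • v) := by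
  rw [pow_succ' (Uq.gen (q ^ 2) Gen.e), mul_smul, gen_smul]

theorem e_pow_smul_mem {q : ℂˣ} (hq : ∀ n : ℕ, 0 < n → q ^ n ≠ 1) {d : ℕ} {C : Set ℕ}
    (hC : ∀ c, c + 2 ∈ C ↔ c ∈ C) {v : PolySpinor} (hv : v ∈ monogenicPart q d C) (n : ℕ) :
    Uq.gen (q ^ 2) Gen.e ^ n • v ∈ monogenicPart q d C := by
  induction n with
  | zero => simpa using hv
  | succ n ih =>
    rw [sigmaGen_e_pow_smul]
    exact gen_mem_monogenicPart hq hC Gen.e ih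

theorem coef_e_pow_smul (q : ℂˣ) {d s : ℕ} {r : ℂ} {v : PolySpinor}
    (h : ∀ c, coef 0 d c v = if c = s then r else 0) (n c : ℕ) :
    coef 0 d c (Uq.gen (q ^ 2) Gen.e ^ n • v)
      = if c = s + 2 * n then (qInt q 2)⁻¹ ^ n * r else 0 := by
  induction n generalizing c with
  | zero => simpa using h c
  | succ n ih =>
    rw [sigmaGen_e_pow_smul]
    rcases lt_or_ge c 2 with hc | hc
    · rw [coef_e_of_lt_two q hc, if_neg (by omega)]
    · obtain ⟨c, rfl⟩ := Nat.exists_eq_add_of_le' hc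
      rw [coef_e_add_two, ih, show s + 2 * (n + 1) = s + 2 * n + 2 by ring]
      simp only [Nat.add_right_cancel_iff, mul_ite, mul_zero, pow_succ', mul_assoc]

/-- If the `x_1`-free part of `v` is a multiple of the lowest one that occurs, then the vectors
`e ^ n • v` span the monogenics. -/
theorem monogenicPart_eq_span {q : ℂˣ} (hq : ∀ n : ℕ, 0 < n → q ^ n ≠ 1) {d s : ℕ} {C : Set ℕ}
    (hC : ∀ c, c + 2 ∈ C ↔ c ∈ C) {r : ℂ} (hr : r ≠ 0) {v : PolySpinor}
    (hv : v ∈ monogenicPart q d C) (h : ∀ c, coef 0 d c v = if c = s then r else 0)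
    (hs : ∀ x ∈ monogenicPart q d C, ∀ c, coef 0 d c x ≠ 0 → ∃ n, c = s + 2 * n) :
    monogenicPart q d C
      = Submodule.span ℂ (Set.range fun n : ℕ => Uq.gen (q ^ 2) Gen.e ^ n • v) := by
  apply le_antisymm
  -- Induction on a bound for the y-exponents of the x_1-free part: subtracting a multiple of e^N v
  -- removes the top term x_2^d y^(s+2N). When nothing is left, x itself is zero.
  · have key : ∀ N : ℕ, ∀ x ∈ monogenicPart q d C, (∀ c, s + 2 * N ≤ c → coef 0 d c x = 0) →
        x ∈ Submodule.span ℂ (Set.range fun n : ℕ => Uq.gen (q ^ 2) Gen.e ^ n • v) := by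
      intro N
      induction N with
      | zero =>
        intro x hx hN
        have hx0 : x = 0 := by
          refine eq_zero_of_coef_zero hq hx.1 fun b c => ?_
          by_contra hne
          obtain rfl : b = d := by simpa using (mem_gradedPart.1 hx.2 0 b c hne).1
          obtain ⟨n, rfl⟩ := hs x hx c hne
          exact hne (hN _ (by omega))
        rw [hx0]
        exact Submodule.zero_mem _
      | succ N ih =>
        intro x hx hN
        set w := Uq.gen (q ^ 2) Gen.e ^ N • v with hw
        have hwm : w ∈ monogenicPart q d C := e_pow_smul_mem hq hC hv N
        set t := coef 0 d (s + 2 * N) x / ((qInt q 2)⁻¹ ^ N * r) with ht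
        have hden : (qInt q 2)⁻¹ ^ N * r ≠ 0 :=
          mul_ne_zero (pow_ne_zero _ (inv_ne_zero (qInt_ne_zero hq two_pos))) hr
        have hsub : x - t • w ∈ monogenicPart q d C :=
          Submodule.sub_mem _ hx (Submodule.smul_mem _ _ hwm)
        have h1 := ih (x - t • w) hsub fun c hc => by
          rw [map_sub, map_smul, hw, coef_e_pow_smul q h, smul_eq_mul]
          by_cases hcN : c = s + 2 * N
          · rw [if_pos hcN, hcN, ht, div_mul_cancel₀ _ hden, sub_self]
          · rw [if_neg hcN, mul_zero, sub_zero]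
            by_contra hne
            obtain ⟨n, rfl⟩ := hs x hx c hne
            exact hne (hN _ (by omega))
        rw [← sub_add_cancel x (t • w)]
        exact Submodule.add_mem _ h1 (Submodule.smul_mem _ _ (Submodule.subset_span ⟨N, rfl⟩))
    intro x hx
    refine key ((spinorBasis.repr x).support.sup (fun i => i.2.2) + 1) x hx fun c hc => ?_
    by_contra hne
    have := Finset.le_sup (f := fun i : ℕ × ℕ × ℕ => i.2.2)
      (Finsupp.mem_support_iff.2 hne : (0, d, c) ∈ (spinorBasis.repr x).support)
    simp only at this
    omega
  · rw [Submodule.span_le]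
    rintro _ ⟨n, rfl⟩
    exact e_pow_smul_mem hq hC hv n

theorem exists_submodule_of_lowestWeight {q l : ℂˣ} (hq : ∀ n : ℕ, 0 < n → q ^ n ≠ 1)
    (hl : ∀ n : ℕ, (l * (q ^ 2) ^ n) ^ 2 ≠ 1) {d s : ℕ} {C : Set ℕ}
    (hC : ∀ c, c + 2 ∈ C ↔ c ∈ C) {r : ℂ} (hr : r ≠ 0) {v : PolySpinor}
    (hv : v ∈ monogenicPart q d C) (h : ∀ c, coef 0 d c v = if c = s then r else 0)
    (hs : ∀ x ∈ monogenicPart q d C, ∀ c, coef 0 d c x ≠ 0 → ∃ n, c = s + 2 * n)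
    (hf : sigmaGen q Gen.f v = 0) (hk : sigmaGen q Gen.k v = (l : ℂ) • v) :
    ∃ N : Submodule (Uq (q ^ 2)) PolySpinor,
      N.restrictScalars ℂ = monogenicPart q d C ∧
      IsSimpleModule (Uq (q ^ 2)) N ∧
      Nonempty (N ≃ₗ[Uq (q ^ 2)] LMod (q ^ 2) l) := by
  have hlow : IsLowestWeight (q ^ 2) l v := ⟨by rw [gen_smul, hf], by rw [gen_smul, hk]⟩
  have hp := sq_pow_ne_one hq
  have hv0 : v ≠ 0 := by
    rintro rfl
    have := h s
    rw [map_zero, if_pos rfl] at this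
    exact hr this.symm
  exact ⟨Submodule.span (Uq (q ^ 2)) {v},
    by rw [hlow.restrictScalars_span hp, monogenicPart_eq_span hq hC hr hv h hs],
    hlow.isSimpleModule_span hp hl hv0, hlow.nonempty_span_equiv hp hl hv0⟩

/-! ### The lowest weight vectors of the even and of the odd monogenics. -/

theorem zpow_ne_one {q : ℂˣ} (hq : ∀ n : ℕ, 0 < n → q ^ n ≠ 1) {z : ℤ} (hz : z ≠ 0) :
    q ^ z ≠ 1 := by
  intro h
  rcases Int.natAbs_eq z with h1 | h1
  · rw [h1, zpow_natCast] at h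
    exact hq _ (by omega) h
  · rw [h1, zpow_neg, zpow_natCast, inv_eq_one] at h
    exact hq _ (by omega) h

/-- The total exponent is 2(z + 2n), and an odd z makes it nonzero. Both 1 - 2d and 3 + 2d are odd.
-/
theorem zpow_mul_sq_ne_one {q : ℂˣ} (hq : ∀ n : ℕ, 0 < n → q ^ n ≠ 1) {z : ℤ} (hz : Odd z)
    (n : ℕ) : (q ^ z * (q ^ 2) ^ n) ^ 2 ≠ 1 := by
  have e : (q ^ z * (q ^ 2) ^ n) ^ 2 = q ^ (2 * (z + 2 * n)) := by
    rw [← pow_mul, ← zpow_natCast q (2 * n), ← zpow_add, ← zpow_natCast, ← zpow_mul]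
    congr 1
    push_cast
    ring
  rw [e]
  obtain ⟨m, rfl⟩ := hz
  exact zpow_ne_one hq (by omega)

theorem exists_submodule_plus {q : ℂˣ} (hq : ∀ n : ℕ, 0 < n → q ^ n ≠ 1) (d : ℕ) :
    ∃ N : Submodule (Uq (q ^ 2)) PolySpinor,
      N.restrictScalars ℂ = monogenicPart q d {c | Even c} ∧
      IsSimpleModule (Uq (q ^ 2)) N ∧
      Nonempty (N ≃ₗ[Uq (q ^ 2)] LMod (q ^ 2) (q ^ (1 - 2 * (d : ℤ)))) := by
  refine exists_submodule_of_lowestWeight hq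
    (zpow_mul_sq_ne_one hq ⟨-d, by ring⟩)
    (fun c => by simp [Nat.even_add]) (s := 0) one_ne_zero (v := mono 0 d 0) ⟨?_, ?_⟩ ?_ ?_ ?_ ?_
  · simp [opF_mono, qInt_zero]
  · exact mono_mem_gradedPart (zero_add d) (by simp)
  · intro c
    simp [coef_mono, eq_comm]
  · intro x hx c hc
    obtain ⟨n, hn⟩ := (mem_gradedPart.1 hx.2 0 d c hc).2
    exact ⟨n, by omega⟩
  · simp [f_mono, qInt_zero]
  · rw [k_mono]
    congr 1
    have e : (q : ℂ) ^ (2 * (d : ℤ)) = (q : ℂ) ^ (2 * d) := by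
      exact_mod_cast zpow_natCast (q : ℂ) (2 * d)
    rw [Units.val_zpow_eq_zpow_val, zpow_sub₀ q.ne_zero, zpow_one, div_eq_mul_inv, e]
    simp

/-- The coefficients of the lowest weight vector of the odd monogenics. -/
def oddCoeff (q : ℂˣ) (d : ℕ) : ℕ → ℂ
  | 0 => 1
  | b + 1 => oddCoeff q d b * qInt (q ^ 2) (d - b)
      / (((q : ℂ) ^ (2 * (d - (b + 1))))⁻¹ * (q : ℂ) ^ (2 * b + 2) * qInt (q ^ 2) (b + 1)
        * qInt q (2 * b + 3))

/-- The lowest weight vector of the odd monogenics of degree `d`. -/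
def oddVec (q : ℂˣ) (d : ℕ) : PolySpinor :=
  ∑ b ∈ Finset.range (d + 1), oddCoeff q d b • mono (d - b) b (2 * b + 1)

theorem oddCoeff_ne_zero {q : ℂˣ} (hq : ∀ n : ℕ, 0 < n → q ^ n ≠ 1) (d b : ℕ) (hb : b ≤ d) :
    oddCoeff q d b ≠ 0 := by
  have hpow : ∀ n : ℕ, (q : ℂ) ^ n ≠ 0 := fun n => pow_ne_zero _ q.ne_zero
  induction b with
  | zero => exact one_ne_zero
  | succ b ih =>
    refine div_ne_zero (mul_ne_zero (ih (by omega)) ?_) (mul_ne_zero (mul_ne_zero (mul_ne_zero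
      (inv_ne_zero (hpow _)) (hpow _)) ?_) ?_)
    · exact qInt_ne_zero (sq_pow_ne_one hq) (by omega)
    · exact qInt_ne_zero (sq_pow_ne_one hq) (by omega)
    · exact qInt_ne_zero hq (by omega)

/-- The recursion of `oddCoeff` makes the lowering term of F on each summand cancel the raising term
on the previous one. The sum telescopes to one boundary term, whose factor [d - n] is zero at n = d.
-/
theorem opF_oddVec {q : ℂˣ} (hq : ∀ n : ℕ, 0 < n → q ^ n ≠ 1) (d : ℕ) :
    opF q (oddVec q d) = 0 := by
  have hpow : ∀ n : ℕ, (q : ℂ) ^ n ≠ 0 := fun n => pow_ne_zero _ q.ne_zero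
  have key : ∀ n : ℕ, opF q (∑ b ∈ Finset.range (n + 1), oddCoeff q d b • mono (d - b) b (2 * b + 1))
      = (oddCoeff q d n * qInt (q ^ 2) (d - n)) • mono (d - n - 1) n (2 * n + 2) := by
    intro n
    induction n with
    | zero => simp [opF_mono, qInt_zero, smul_smul]
    | succ n ih =>
      rw [Finset.sum_range_succ, map_add, ih, map_smul, opF_mono, smul_sub, smul_smul, smul_smul]
      have e : oddCoeff q d (n + 1) * (((q : ℂ) ^ (2 * (d - (n + 1))))⁻¹
          * (q : ℂ) ^ (2 * (n + 1) + 1 - 1) * qInt (q ^ 2) (n + 1) * qInt q (2 * (n + 1) + 1))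
          = oddCoeff q d n * qInt (q ^ 2) (d - n) := by
        rw [oddCoeff]
        refine div_mul_cancel₀ _ ?_
        refine mul_ne_zero (mul_ne_zero (mul_ne_zero (inv_ne_zero (hpow _)) (hpow _)) ?_) ?_
        · exact qInt_ne_zero (sq_pow_ne_one hq) (by omega)
        · exact qInt_ne_zero hq (by omega)
      rw [e, show d - (n + 1) = d - n - 1 by omega, show 2 * (n + 1) + 1 - 1 = 2 * n + 2 by omega,
        show 2 * (n + 1) + 1 + 1 = 2 * (n + 1) + 2 by omega, show n + 1 - 1 = n by omega]
      abel
  rw [oddVec, key]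
  simp [qInt_zero]

theorem coef_oddVec (q : ℂˣ) (d a b c : ℕ) : coef a b c (oddVec q d)
    = if a + b = d ∧ c = 2 * b + 1 then oddCoeff q d b else 0 := by
  rw [oddVec, map_sum]
  simp only [map_smul, coef_mono, smul_eq_mul, mul_ite, mul_one, mul_zero]
  split_ifs with h
  · rw [Finset.sum_eq_single_of_mem b (Finset.mem_range.2 (by omega)), if_pos (by omega)]
    intro b' _ hb'
    rw [if_neg (by omega)]
  · refine Finset.sum_eq_zero fun b' hb' => ?_
    rw [Finset.mem_range] at hb'
    rw [if_neg (by omega)]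

theorem oddVec_mem {q : ℂˣ} (hq : ∀ n : ℕ, 0 < n → q ^ n ≠ 1) (d : ℕ) :
    oddVec q d ∈ monogenicPart q d {c | Odd c} := by
  refine ⟨opF_oddVec hq d, mem_gradedPart.2 fun a b c h => ?_⟩
  rw [coef_oddVec] at h
  obtain ⟨h1, rfl⟩ := (ite_ne_right_iff.1 h).1
  exact ⟨h1, odd_two_mul_add_one b⟩

theorem coef_f_oddVec (q : ℂˣ) (d a b c : ℕ) (h : 2 * b + 1 ≤ c) :
    coef a b c (sigmaGen q Gen.f (oddVec q d)) = 0 := by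
  rw [oddVec, map_sum, map_sum]
  refine Finset.sum_eq_zero fun b' _ => ?_
  rw [map_smul, f_mono, map_smul, map_sub, map_smul, map_smul, coef_mono, coef_mono,
    if_neg (by omega), if_neg (by omega)]
  simp

/-- No coefficients need comparing. Since f moves the line c = 2b+1 to c = 2b-1, the result has
coefficients only at c < 2b+1, and there an odd monogenic has none. -/
theorem f_oddVec {q : ℂˣ} (hq : ∀ n : ℕ, 0 < n → q ^ n ≠ 1) (d : ℕ) :
    sigmaGen q Gen.f (oddVec q d) = 0 := by
  refine eq_zero_of_coef fun a b c => ?_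
  rcases lt_or_ge c (2 * b + 1) with hc | hc
  · exact coef_eq_zero_of_odd hq (gen_mem_monogenicPart hq
      (fun c => by simp [Nat.odd_add]) Gen.f (oddVec_mem hq d)) a b c hc
  · exact coef_f_oddVec q d a b c hc

theorem k_oddVec (q : ℂˣ) (d : ℕ) :
    sigmaGen q Gen.k (oddVec q d) = ((q ^ (3 + 2 * (d : ℤ)) : ℂˣ) : ℂ) • oddVec q d := by
  rw [oddVec, map_sum, Finset.smul_sum]
  refine Finset.sum_congr rfl fun b hb => ?_
  rw [Finset.mem_range] at hb
  obtain ⟨a, rfl⟩ := Nat.exists_eq_add_of_le (Nat.lt_succ_iff.1 hb)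
  rw [map_smul, k_mono, smul_comm]
  congr 1
  have e : (3 + 2 * ((b + a : ℕ) : ℤ)) = ((3 + 2 * (b + a) : ℕ) : ℤ) := by push_cast; ring
  have hpow : (q : ℂ) ^ (2 * b) ≠ 0 := pow_ne_zero _ q.ne_zero
  rw [e, zpow_natCast, Units.val_pow_eq_pow_val, Nat.add_sub_cancel_left]
  field_simp
  ring

theorem exists_submodule_minus {q : ℂˣ} (hq : ∀ n : ℕ, 0 < n → q ^ n ≠ 1) (d : ℕ) :
    ∃ N : Submodule (Uq (q ^ 2)) PolySpinor,
      N.restrictScalars ℂ = monogenicPart q d {c | Odd c} ∧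
      IsSimpleModule (Uq (q ^ 2)) N ∧
      Nonempty (N ≃ₗ[Uq (q ^ 2)] LMod (q ^ 2) (q ^ (3 + 2 * (d : ℤ)))) := by
  refine exists_submodule_of_lowestWeight hq
    (zpow_mul_sq_ne_one hq ⟨d + 1, by ring⟩)
    (fun c => by simp [Nat.odd_add]) (s := 2 * d + 1) (oddCoeff_ne_zero hq d d le_rfl)
    (oddVec_mem hq d) ?_ ?_ (f_oddVec hq d) (k_oddVec q d)
  · intro c
    simp [coef_oddVec]
  · intro x hx c hc
    obtain ⟨n, hn⟩ := (mem_gradedPart.1 hx.2 0 d c hc).2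
    have h1 : 2 * d + 1 ≤ c := by
      by_contra h1
      exact hc (coef_eq_zero_of_odd hq hx 0 d c (by omega))
    exact ⟨n - d, by omega⟩

/-! ### Splitting the monogenics by parity in y. -/

theorem disjoint_gradedPart (d : ℕ) {C C' : Set ℕ} (h : Disjoint C C') :
    Disjoint (gradedPart d C) (gradedPart d C') := by
  rw [Submodule.disjoint_def]
  intro x hx hx'
  refine eq_zero_of_coef fun a b c => ?_
  by_contra hne
  exact Set.disjoint_left.1 h (mem_gradedPart.1 hx a b c hne).2 (mem_gradedPart.1 hx' a b c hne).2

theorem gradedPart_sup (d : ℕ) (C C' : Set ℕ) :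
    gradedPart d C ⊔ gradedPart d C' = gradedPart d (C ∪ C') := by
  rw [gradedPart, gradedPart, gradedPart, ← Submodule.span_union, ← Set.image_union]
  congr 2
  ext i
  simp only [Set.mem_union, Set.mem_ofPred_eq]
  tauto

theorem disjoint_even_odd : Disjoint {c : ℕ | Even c} {c : ℕ | Odd c} :=
  Set.disjoint_left.2 fun _ h h' => Nat.not_odd_iff_even.2 h h'

theorem monogenicPart_even_sup_odd (q : ℂˣ) (d : ℕ) :
    monogenicPart q d {c | Even c} ⊔ monogenicPart q d {c | Odd c}
      = monogenicPart q d Set.univ := by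
  apply le_antisymm
  · exact sup_le (inf_le_inf_left _ (gradedPart_mono (Set.subset_univ _)))
      (inf_le_inf_left _ (gradedPart_mono (Set.subset_univ _)))
  · rintro x ⟨hF, hx⟩
    have hu : (Set.univ : Set ℕ) = {c | Even c} ∪ {c | Odd c} := by
      ext c
      simpa using Nat.even_or_odd c
    rw [hu, ← gradedPart_sup] at hx
    obtain ⟨y, hy, z, hz, rfl⟩ := Submodule.mem_sup.1 hx
    replace hF : opF q (y + z) = 0 := hF
    rw [map_add] at hF
    have hy' : opF q y ∈ gradedPart (d - 1) {c | Odd c} :=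
      opF_mem_gradedPart (d := d) {c | Even c} {c | Odd c} (fun c (hc : Even c) => hc.add_one)
        (fun c (hc : Even (c + 1)) => Nat.not_even_iff_odd.1 (Nat.even_add_one.1 hc)) hy
    have hz' : opF q z ∈ gradedPart (d - 1) {c | Even c} :=
      opF_mem_gradedPart (d := d) {c | Odd c} {c | Even c} (fun c (hc : Odd c) => hc.add_one)
        (fun c (hc : Odd (c + 1)) => Nat.not_odd_iff_even.1 (Nat.odd_add_one.1 hc)) hz
    -- F y is odd and F z is even, so F y = -F z lies in both parity parts and vanishes.
    have hy0 : opF q y = 0 := by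
      refine Submodule.disjoint_def.1 (disjoint_gradedPart (d - 1) disjoint_even_odd) _ ?_ hy'
      rw [eq_neg_of_add_eq_zero_left hF]
      exact Submodule.neg_mem _ hz'
    rw [hy0, zero_add] at hF
    exact Submodule.add_mem_sup ⟨hy0, hy⟩ ⟨hF, hz⟩

/-! ### The Fischer decomposition -/

/-- Minus the eigenvalue of `opE' q ∘ opF q` on `opE' q ^ k` of the monogenics of degree `n`. -/
def fischerCoeff (q : ℂˣ) (n k : ℕ) : ℂ := ∑ j ∈ Finset.range k, qInt (q ^ 2) (n + j + 1)

/-- With denominators cleared, this says that the sum equals [k]_q [2n+k+1]_q / [2]_q. -/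
theorem fischerCoeff_eq {q : ℂˣ} (hq : ∀ n : ℕ, 0 < n → q ^ n ≠ 1) (n k : ℕ) :
    (((q : ℂ) ^ 2 - 1) ^ 2 * ((q : ℂ) ^ 2 + 1) * ((q : ℂ) ^ 2) ^ (n + k)) * fischerCoeff q n k
      = (q : ℂ) ^ 2 * ((((q : ℂ) ^ 2) ^ k - 1) * (((q : ℂ) ^ 2) ^ (2 * n + k + 1) - 1)) := by
  have h0 : (q : ℂ) ≠ 0 := q.ne_zero
  have h1 := pow_sub_one_ne_zero hq (n := 2) (by norm_num)
  have h2 := sq_add_one_ne_zero hq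
  induction k with
  | zero => simp [fischerCoeff]
  | succ k ih =>
    have e : (((q : ℂ) ^ 2 - 1) ^ 2 * ((q : ℂ) ^ 2 + 1) * ((q : ℂ) ^ 2) ^ (n + (k + 1)))
        * qInt (q ^ 2) (n + k + 1)
        = (q : ℂ) ^ 2 * ((q : ℂ) ^ 2 - 1) * (((q : ℂ) ^ 2) ^ (2 * (n + k + 1)) - 1) := by
      rw [qInt_sq_eq]
      field_simp
      ring
    rw [fischerCoeff, Finset.sum_range_succ, ← fischerCoeff, mul_add, e]
    linear_combination (q : ℂ) ^ 2 * ih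

theorem fischerCoeff_ne_zero {q : ℂˣ} (hq : ∀ n : ℕ, 0 < n → q ^ n ≠ 1) (n : ℕ) {k : ℕ}
    (hk : 0 < k) : fischerCoeff q n k ≠ 0 := by
  intro h
  have h1 := fischerCoeff_eq hq n k
  rw [h, mul_zero, ← pow_mul, ← pow_mul] at h1
  exact mul_ne_zero (pow_ne_zero 2 q.ne_zero) (mul_ne_zero (pow_sub_one_ne_zero hq (by omega))
    (pow_sub_one_ne_zero hq (by omega))) h1.symm

theorem pow_injective {q : ℂˣ} (hq : ∀ n : ℕ, 0 < n → q ^ n ≠ 1) {m n : ℕ}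
    (h : (q : ℂ) ^ m = (q : ℂ) ^ n) : m = n := by
  have h' : q ^ (m : ℤ) = q ^ (n : ℤ) := by
    ext
    simpa using h
  by_contra hne
  refine zpow_ne_one hq (z := m - n) (by omega) ?_
  rw [zpow_sub, h', mul_inv_cancel]

/-- For n = d - k the prefactor in `fischerCoeff_eq` depends only on d. The numbers u = q^(2k) and w
= q^(2(2d+1-k)) have a product independent of k, so equal values of (u-1)(w-1) mean equal sums u +
w, hence equal pairs up to order. The swap would require k + l = 2d+1, impossible for k, l ≤ d. -/
theorem fischerCoeff_injective {q : ℂˣ} (hq : ∀ n : ℕ, 0 < n → q ^ n ≠ 1) {d k l : ℕ}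
    (hk : k ≤ d) (hl : l ≤ d) (h : fischerCoeff q (d - k) k = fischerCoeff q (d - l) l) :
    k = l := by
  have h1 := fischerCoeff_eq hq (d - k) k
  have h2 := fischerCoeff_eq hq (d - l) l
  rw [Nat.sub_add_cancel hk] at h1
  rw [Nat.sub_add_cancel hl, ← h, h1] at h2
  have h3 := mul_left_cancel₀ (pow_ne_zero 2 q.ne_zero) h2
  have ek : ((q : ℂ) ^ 2) ^ k * ((q : ℂ) ^ 2) ^ (2 * (d - k) + k + 1)
      = ((q : ℂ) ^ 2) ^ (2 * d + 1) := by
    rw [← pow_add]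
    congr 1
    omega
  have el : ((q : ℂ) ^ 2) ^ l * ((q : ℂ) ^ 2) ^ (2 * (d - l) + l + 1)
      = ((q : ℂ) ^ 2) ^ (2 * d + 1) := by
    rw [← pow_add]
    congr 1
    omega
  -- Both pairs being the roots of one quadratic polynomial, the root belonging to k is substituted
  -- into the factorisation belonging to l.
  have h4 : (((q : ℂ) ^ 2) ^ k - ((q : ℂ) ^ 2) ^ l)
      * (((q : ℂ) ^ 2) ^ k - ((q : ℂ) ^ 2) ^ (2 * (d - l) + l + 1)) = 0 := by
    linear_combination -((q : ℂ) ^ 2) ^ k * h3 + (1 - ((q : ℂ) ^ 2) ^ k) * (el - ek)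
  rcases mul_eq_zero.1 h4 with h5 | h5
  · rw [sub_eq_zero, ← pow_mul, ← pow_mul] at h5
    have := pow_injective hq h5
    omega
  · rw [sub_eq_zero, ← pow_mul, ← pow_mul] at h5
    have := pow_injective hq h5
    omega

theorem opE'_opF_pow {q : ℂˣ} (hq : ∀ n : ℕ, 0 < n → q ^ n ≠ 1) {n : ℕ} {x : PolySpinor}
    (hx : x ∈ monogenicPart q n Set.univ) (k : ℕ) :
    opE' q (opF q ((opE' q ^ k) x)) = -(fischerCoeff q n k • (opE' q ^ k) x) := by
  induction k with
  | zero =>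
    have : opF q x = 0 := hx.1
    simp [fischerCoeff, this]
  | succ k ih =>
    rw [pow_succ', Module.End.mul_apply, opF_opE' hq (opE'_pow_mem_gradedPart k hx.2), ih,
      fischerCoeff, fischerCoeff, Finset.sum_range_succ]
    simp only [map_sub, map_neg, map_smul, add_smul]
    abel

/-- The composite in the other order is a scalar too, with k + 1 in place of k. That scalar is never
zero, which makes F E' invertible on each summand. -/
theorem opF_opE'_pow {q : ℂˣ} (hq : ∀ n : ℕ, 0 < n → q ^ n ≠ 1) {n : ℕ} {x : PolySpinor}
    (hx : x ∈ monogenicPart q n Set.univ) (k : ℕ) :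
    opF q (opE' q ((opE' q ^ k) x)) = -(fischerCoeff q n (k + 1) • (opE' q ^ k) x) := by
  rw [opF_opE' hq (opE'_pow_mem_gradedPart k hx.2), opE'_opF_pow hq hx, fischerCoeff, fischerCoeff,
    Finset.sum_range_succ, add_smul]
  abel

/-- The summand `E^k (M^{d-k})` of the Fischer decomposition. -/
def fischerPart (q : ℂˣ) (d k : ℕ) : Submodule ℂ PolySpinor :=
  (monogenicPart q (d - k) Set.univ).map (opE' q ^ k)

/-- The nonzero scalar [2]_q^k does not change the image. -/
theorem map_opE_pow {q : ℂˣ} (hq : ∀ n : ℕ, 0 < n → q ^ n ≠ 1) (d k : ℕ) :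
    (monogenic q (d - k)).map (opE q ^ k) = fischerPart q d k := by
  rw [opE_eq, smul_pow, Submodule.map_smul _ _ _ (pow_ne_zero _ (qInt_ne_zero hq two_pos)),
    monogenic_eq, fischerPart]

theorem gen_mem_fischerPart {q : ℂˣ} (hq : ∀ n : ℕ, 0 < n → q ^ n ≠ 1) (d k : ℕ) (g : Gen)
    (x : PolySpinor) (hx : x ∈ fischerPart q d k) :
    Uq.gen (q ^ 2) g • x ∈ fischerPart q d k := by
  obtain ⟨y, hy, rfl⟩ := hx
  rw [gen_smul, ← opE'_pow_comm_gen hq]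
  exact Submodule.mem_map_of_mem (gen_mem_monogenicPart hq (fun _ => by simp) g hy)

/-- The summands lie in eigenspaces of E' F for pairwise distinct eigenvalues. -/
theorem iSupIndep_fischerPart {q : ℂˣ} (hq : ∀ n : ℕ, 0 < n → q ^ n ≠ 1) (d : ℕ) :
    iSupIndep fun k : Fin (d + 1) => fischerPart q d k := by
  have hinj : Function.Injective fun k : Fin (d + 1) => -fischerCoeff q (d - k) k := by
    intro k l h
    exact Fin.ext (fischerCoeff_injective hq (Nat.lt_succ_iff.1 k.2) (Nat.lt_succ_iff.1 l.2)
      (neg_injective h))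
  refine ((Module.End.eigenspaces_iSupIndep (opE' q * opF q)).comp hinj).mono fun k => ?_
  rintro _ ⟨x, hx, rfl⟩
  rw [Function.comp_apply, Module.End.mem_eigenspace_iff, Module.End.mul_apply,
    opE'_opF_pow hq hx, neg_smul]

theorem fischerPart_le (q : ℂˣ) {d k : ℕ} (hk : k ≤ d) :
    fischerPart q d k ≤ gradedPart d Set.univ := by
  rintro _ ⟨x, hx, rfl⟩
  have h := opE'_pow_mem_gradedPart (q := q) k hx.2
  rwa [Nat.sub_add_cancel hk] at h

theorem opE'_mem_fischerPart {q : ℂˣ} {d k : ℕ} {x : PolySpinor} (hx : x ∈ fischerPart q d k) :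
    opE' q x ∈ fischerPart q (d + 1) (k + 1) := by
  obtain ⟨y, hy, rfl⟩ := hx
  refine ⟨y, ?_, by rw [pow_succ', Module.End.mul_apply]⟩
  rwa [Nat.add_sub_add_right]

theorem iSup_fischerPart {q : ℂˣ} (hq : ∀ n : ℕ, 0 < n → q ^ n ≠ 1) (d : ℕ) :
    ⨆ k : Fin (d + 1), fischerPart q d k = gradedPart d Set.univ := by
  refine le_antisymm (iSup_le fun k => fischerPart_le q (Nat.lt_succ_iff.1 k.2)) ?_
  have hzero : ∀ d, monogenicPart q d Set.univ ≤ ⨆ k : Fin (d + 1), fischerPart q d k := by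
    intro d x hx
    exact Submodule.mem_iSup_of_mem (0 : Fin (d + 1)) ⟨x, hx, rfl⟩
  induction d with
  | zero =>
    intro x hx
    exact hzero 0 ⟨opF_eq_zero_of_degree_zero hx, hx⟩
  | succ d ih =>
    -- F E' acts on each summand of degree d by a nonzero scalar, so a preimage is obtained by
    -- dividing by it.
    have hsurj : (⨆ k : Fin (d + 1), fischerPart q d k)
        ≤ (⨆ k : Fin (d + 1), fischerPart q d k).map (opF q ∘ₗ opE' q) := by
      refine iSup_le fun k => ?_
      rintro _ ⟨x, hx, rfl⟩
      refine ⟨-(fischerCoeff q (d - k) (k + 1))⁻¹ • (opE' q ^ (k : ℕ)) x,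
        Submodule.smul_mem _ _ (Submodule.mem_iSup_of_mem k ⟨x, hx, rfl⟩), ?_⟩
      rw [map_smul, LinearMap.comp_apply, opF_opE'_pow hq hx, smul_neg, neg_smul, neg_neg,
        inv_smul_smul₀ (fischerCoeff_ne_zero hq _ (Nat.succ_pos _))]
    have hE : (⨆ k : Fin (d + 1), fischerPart q d k).map (opE' q)
        ≤ ⨆ k : Fin (d + 1 + 1), fischerPart q (d + 1) k := by
      rw [Submodule.map_iSup]
      refine iSup_le fun k => ?_
      rintro _ ⟨x, hx, rfl⟩
      exact Submodule.mem_iSup_of_mem k.succ (opE'_mem_fischerPart hx)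
    intro x hx
    have hFx : opF q x ∈ gradedPart d Set.univ :=
      opF_mem_gradedPart (d := d + 1) Set.univ Set.univ (fun _ _ => Set.mem_univ _)
        (fun _ _ => Set.mem_univ _) hx
    obtain ⟨y, hy, hyx⟩ := hsurj (ih hFx)
    have hEy := hE (Submodule.mem_map_of_mem hy)
    have hyd : y ∈ gradedPart d Set.univ :=
      (iSup_le fun k => fischerPart_le q (Nat.lt_succ_iff.1 k.2) :
        (⨆ k : Fin (d + 1), fischerPart q d k) ≤ _) hy
    -- As y was chosen with F E' y = F x, the difference is monogenic: it is the summand k = 0,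
    -- while E' y lies in the summands k ≥ 1.
    have hsub : x - opE' q y ∈ monogenicPart q (d + 1) Set.univ := by
      refine ⟨?_, Submodule.sub_mem _ hx (opE'_mem_gradedPart hyd)⟩
      change opF q (x - opE' q y) = 0
      rw [map_sub, sub_eq_zero]
      exact hyx.symm
    rw [← sub_add_cancel x (opE' q y)]
    exact Submodule.add_mem _ (hzero _ hsub) hEy

end QMeta

end

theorem theorem5p9 (q : ℂˣ) (hq : ∀ n : ℕ, 0 < n → q ^ n ≠ 1) (d : ℕ) :
    -- `M^d = M^d_+ ⊕ M^d_-`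
    (Disjoint (QMeta.monogenicPlus q d) (QMeta.monogenicMinus q d) ∧
      QMeta.monogenicPlus q d ⊔ QMeta.monogenicMinus q d = QMeta.monogenic q d) ∧
    -- `M^d_+` is an irreducible `U_{q²}`-submodule, isomorphic to `L_{q²}(1/2 - d)`
    (∃ N : Submodule (QMeta.Uq (q ^ 2)) QMeta.PolySpinor,
      N.restrictScalars ℂ = QMeta.monogenicPlus q d ∧
      IsSimpleModule (QMeta.Uq (q ^ 2)) N ∧
      Nonempty (N ≃ₗ[QMeta.Uq (q ^ 2)] QMeta.LMod (q ^ 2) (q ^ (1 - 2 * (d : ℤ))))) ∧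
    -- `M^d_-` is an irreducible `U_{q²}`-submodule, isomorphic to `L_{q²}(3/2 + d)`
    (∃ N : Submodule (QMeta.Uq (q ^ 2)) QMeta.PolySpinor,
      N.restrictScalars ℂ = QMeta.monogenicMinus q d ∧
      IsSimpleModule (QMeta.Uq (q ^ 2)) N ∧
      Nonempty (N ≃ₗ[QMeta.Uq (q ^ 2)] QMeta.LMod (q ^ 2) (q ^ (3 + 2 * (d : ℤ))))) ∧
    -- `P(S)^d` is the internal direct sum of the `E^k (M^{d-k})`, `0 ≤ k ≤ d`,
    -- and each summand is a `U_{q²}`-submodule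
    (∀ k : ℕ, k ≤ d → ∃ N : Submodule (QMeta.Uq (q ^ 2)) QMeta.PolySpinor,
      N.restrictScalars ℂ = (QMeta.monogenic q (d - k)).map (QMeta.opE q ^ k)) ∧
    iSupIndep (fun k : Fin (d + 1) => (QMeta.monogenic q (d - k)).map (QMeta.opE q ^ (k : ℕ))) ∧
    (⨆ k : Fin (d + 1), (QMeta.monogenic q (d - k)).map (QMeta.opE q ^ (k : ℕ)))
      = QMeta.polySpinorDeg d := by
  simp only [QMeta.map_opE_pow hq]
  rw [QMeta.monogenicPlus_eq, QMeta.monogenicMinus_eq, QMeta.monogenic_eq, QMeta.polySpinorDeg_eq]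
  exact ⟨⟨(QMeta.disjoint_gradedPart d QMeta.disjoint_even_odd).mono inf_le_right inf_le_right,
    QMeta.monogenicPart_even_sup_odd q d⟩, QMeta.exists_submodule_plus hq d,
    QMeta.exists_submodule_minus hq d,
    fun k _ => QMeta.exists_restrictScalars_eq (QMeta.gen_mem_fischerPart hq d k),
    QMeta.iSupIndep_fischerPart hq d, QMeta.iSup_fischerPart hq d⟩
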